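/- Let $n \ge 1$ and equip $\mathbb{R}^{2n} = \mathbb{C}^n$ with the standard symplectic form $\omega_0 = \sum_{i=1}^n dx_i \wedge dy_i$. For $a_i>0$ let $D(a_i) = \{ z \in \mathbb{C} : \pi |z|^2 < a_i \}$ be the open disc of area $a_i$, let $P^{2n}(a_1,\dots,a_n) = D(a_1) \times \dots \times D(a_n)$, and let $C^{2n}(A) = P^{2n}(A,\dots,A)$. A symplectic embedding of an open set $U \subset \mathbb{C}^n$ into $V \subset \mathbb{C}^n$ is a smooth embedding $\varphi \colon U \to \mathbb{C}^n$ with $\varphi(U) \subset V$ and $\varphi^*\omega_0 = \omega_0$. For $a > 2\pi$ define \[ s_{PC}^{2n}(a) = \begin{cases} (N+1)\pi, & (N-1)N^{n-1} < \frac{a}{\pi}-2 \le (N-1)(N+1)^{n-1}, \\[2pt] \frac{a-2\pi}{(N+1)^{n-1}}+2\pi, & (N-1)(N+1)^{n-1} < \frac{a}{\pi}-2 \le N(N+1)^{n-1}, \end{cases} \] where $N$ ranges over the integers $N \ge 1$ (exactly one case, for exactly one $N$, applies to each $a>2\pi$). Then for all $a > 2\pi$ and $\epsilon > 0$ there is a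 symplectic embedding of $P^{2n}(\pi,\dots,\pi,a)$ (with $n-1$ entries $\pi$) into $C^{2n}(s_{PC}^{2n}(a)+\epsilon)$. Moreover, for $n=2$ and all $a>2\pi$, \[ s_{PC}^{4}(a) = \begin{cases} (N+1)\pi, & (N-1)N+2 < \frac{a}{\pi} \le N^2+1, \\[2pt] \frac{a+2N\pi}{N+1}, & N^2+1 < \frac{a}{\pi} \le N(N+1)+2, \end{cases} \qquad N \ge 1. \] -/

import Mathlib

open Set
open scoped ContDiff

/-- The standard symplectic form `ω₀ = ∑ dxᵢ ∧ dyᵢ` on `ℂⁿ = ℝ²ⁿ`, where `zᵢ = xᵢ + i yᵢ`. -/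
def stdSymplecticForm {n : ℕ} (u v : Fin n → ℂ) : ℝ :=
  ∑ i, ((u i).re * (v i).im - (u i).im * (v i).re)

/-- `φ` restricts to a symplectic embedding of the open set `U ⊆ ℂⁿ` into `ℂⁿ`: it is smooth (over
`ℝ`) on `U`, is a homeomorphism from `U` onto its image, and satisfies `φ^* ω₀ = ω₀` on `U`
(which makes it an immersion there). -/
structure IsSymplecticEmbeddingOn {n : ℕ} (φ : (Fin n → ℂ) → (Fin n → ℂ))
    (U : Set (Fin n → ℂ)) : Prop where
  contDiffOn : ContDiffOn ℝ ∞ φ U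
  isEmbedding : Topology.IsEmbedding (U.domRestrict φ)
  pullback_eq : ∀ z ∈ U, ∀ u v : Fin n → ℂ,
    stdSymplecticForm (fderiv ℝ φ z u) (fderiv ℝ φ z v) = stdSymplecticForm u v

/-- The open set `U ⊆ ℂⁿ` embeds symplectically in `V ⊆ ℂⁿ`. -/
def SymplecticallyEmbeds {n : ℕ} (U V : Set (Fin n → ℂ)) : Prop :=
  ∃ φ : (Fin n → ℂ) → (Fin n → ℂ), IsSymplecticEmbeddingOn φ U ∧ MapsTo φ U V

/-- The open disc `D(a)` of area `a` centred at the origin. -/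
def openDisc (a : ℝ) : Set ℂ := {z | Real.pi * ‖z‖ ^ 2 < a}

/-- The open polydisc `P(a₁, …, aₙ) = D(a₁) × ⋯ × D(aₙ)`. -/
def polydisc {n : ℕ} (a : Fin n → ℝ) : Set (Fin n → ℂ) := {z | ∀ i, z i ∈ openDisc (a i)}

/-- The polydisc `P²ⁿ(π, …, π, a)`, with `n - 1` entries `π` and last entry `a`. -/
def skinnyPolydisc (n : ℕ) (a : ℝ) : Set (Fin n → ℂ) :=
  polydisc (fun i : Fin n => if (i : ℕ) + 1 = n then a else Real.pi)

/-- The cube `C²ⁿ(A) = P²ⁿ(A, …, A)`. -/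
def symplecticCube (n : ℕ) (A : ℝ) : Set (Fin n → ℂ) := polydisc (fun _ : Fin n => A)

theorem isOpen_polydisc {n : ℕ} (a : Fin n → ℝ) : IsOpen (polydisc a) := by
  have h : polydisc a = ⋂ i, {z : Fin n → ℂ | Real.pi * ‖z i‖ ^ 2 < a i} := by
    ext z; simp [polydisc, openDisc]
  rw [h]
  exact isOpen_iInter_of_finite fun i => isOpen_lt (by fun_prop) (by fun_prop)

/-- For `a > 2π`, the unique integer `N ≥ 1` such that
`(N - 1) N^(n-1) < a/π - 2 ≤ N (N + 1)^(n-1)`. -/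
noncomputable def foldNumber (n : ℕ) (a : ℝ) : ℕ :=
  sInf {N : ℕ | 1 ≤ N ∧ a / Real.pi - 2 ≤ (N : ℝ) * ((N : ℝ) + 1) ^ (n - 1)}

open Classical in
/-- The function `s_PC²ⁿ(a)`, for `n ≥ 1` and `a > 2π`. With `N = foldNumber n a` it equals
`(N + 1) π` on the lower part of the `N`-th interval, up to `(N - 1) (N + 1)^(n-1)`, and
`(a - 2π) / (N + 1)^(n-1) + 2π` on the upper part; see `sPC_eq_lower`, `sPC_eq_upper` and
`exists_foldNumber`. -/
noncomputable def sPC (n : ℕ) (a : ℝ) : ℝ :=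
  if a / Real.pi - 2 ≤ ((foldNumber n a : ℝ) - 1) * ((foldNumber n a : ℝ) + 1) ^ (n - 1) then
    ((foldNumber n a : ℝ) + 1) * Real.pi
  else
    (a - 2 * Real.pi) / ((foldNumber n a : ℝ) + 1) ^ (n - 1) + 2 * Real.pi

theorem exists_foldNumber (n : ℕ) (a : ℝ) (ha : 2 * Real.pi < a) :
    ∃ N : ℕ, 1 ≤ N ∧ ((N : ℝ) - 1) * (N : ℝ) ^ (n - 1) < a / Real.pi - 2 ∧
      a / Real.pi - 2 ≤ (N : ℝ) * ((N : ℝ) + 1) ^ (n - 1) := by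
  classical
  have hpos : 0 < a / Real.pi - 2 := by
    have := (lt_div_iff₀ Real.pi_pos).2 ha
    linarith
  have hex : ∃ N : ℕ, a / Real.pi - 2 ≤ (N : ℝ) * ((N : ℝ) + 1) ^ (n - 1) := by
    obtain ⟨N, hN⟩ := exists_nat_ge (a / Real.pi - 2)
    refine ⟨N, hN.trans (le_mul_of_one_le_right (Nat.cast_nonneg N) (one_le_pow₀ ?_))⟩
    have : (0 : ℝ) ≤ N := Nat.cast_nonneg N
    linarith
  have h0 : Nat.find hex ≠ 0 := by
    intro h
    have := Nat.find_spec hex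
    rw [h] at this
    norm_num at this
    linarith
  obtain ⟨m, hm⟩ := Nat.exists_eq_succ_of_ne_zero h0
  refine ⟨Nat.find hex, by omega, ?_, Nat.find_spec hex⟩
  have hlt := not_le.1 (Nat.find_min hex (m := m) (by omega))
  rw [hm]
  push_cast
  simpa using hlt

theorem foldNumber_eq (n : ℕ) (a : ℝ) (N : ℕ) (hN : 1 ≤ N)
    (h₁ : ((N : ℝ) - 1) * (N : ℝ) ^ (n - 1) < a / Real.pi - 2)
    (h₂ : a / Real.pi - 2 ≤ (N : ℝ) * ((N : ℝ) + 1) ^ (n - 1)) : foldNumber n a = N := by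
  have hmem : N ∈ {N : ℕ | 1 ≤ N ∧ a / Real.pi - 2 ≤ (N : ℝ) * ((N : ℝ) + 1) ^ (n - 1)} :=
    ⟨hN, h₂⟩
  refine le_antisymm (Nat.sInf_le hmem) ?_
  by_contra hlt
  have hs := (Nat.sInf_mem ⟨N, hmem⟩).2
  change a / Real.pi - 2 ≤ (foldNumber n a : ℝ) * ((foldNumber n a : ℝ) + 1) ^ (n - 1) at hs
  have hle : (foldNumber n a : ℝ) + 1 ≤ N := by exact_mod_cast not_le.1 hlt
  have h0 : (0 : ℝ) ≤ foldNumber n a := Nat.cast_nonneg _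
  have : (foldNumber n a : ℝ) * ((foldNumber n a : ℝ) + 1) ^ (n - 1) ≤
      ((N : ℝ) - 1) * (N : ℝ) ^ (n - 1) :=
    mul_le_mul (by linarith) (pow_le_pow_left₀ (by linarith) hle _) (by positivity) (by linarith)
  linarith

theorem sPC_eq_lower (n : ℕ) (a : ℝ) (N : ℕ) (hN : 1 ≤ N)
    (h₁ : ((N : ℝ) - 1) * (N : ℝ) ^ (n - 1) < a / Real.pi - 2)
    (h₂ : a / Real.pi - 2 ≤ ((N : ℝ) - 1) * ((N : ℝ) + 1) ^ (n - 1)) :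
    sPC n a = ((N : ℝ) + 1) * Real.pi := by
  have hp : (0 : ℝ) ≤ ((N : ℝ) + 1) ^ (n - 1) := by positivity
  rw [sPC, foldNumber_eq n a N hN h₁ (by linarith), if_pos h₂]

theorem sPC_eq_upper (n : ℕ) (a : ℝ) (N : ℕ) (hN : 1 ≤ N)
    (h₁ : ((N : ℝ) - 1) * ((N : ℝ) + 1) ^ (n - 1) < a / Real.pi - 2)
    (h₂ : a / Real.pi - 2 ≤ (N : ℝ) * ((N : ℝ) + 1) ^ (n - 1)) :
    sPC n a = (a - 2 * Real.pi) / ((N : ℝ) + 1) ^ (n - 1) + 2 * Real.pi := by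
  have hN' : (1 : ℝ) ≤ N := by exact_mod_cast hN
  have hp : ((N : ℝ) - 1) * (N : ℝ) ^ (n - 1) ≤ ((N : ℝ) - 1) * ((N : ℝ) + 1) ^ (n - 1) :=
    mul_le_mul_of_nonneg_left (pow_le_pow_left₀ (by linarith) (by linarith) _) (by linarith)
  rw [sPC, foldNumber_eq n a N hN (by linarith) h₂, if_neg (not_le.2 h₁)]

/-! The embedding wraps the long factor around an annulus while the other factors move along a
lattice path. Write m = n - 1 and let A be the area of each target disc. After area preserving
changes of coordinates, the m small discs are rectangles of width π and height one, and the disc of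
area a is a strip |V| < u'(θ)/2. The symplectic `shear` moves the fibre over θ by C(θ) in the height
directions, at the price of shifting V by C'(θ)·x + κ(θ). Then θ is taken modulo one by `wrap`, so
that the strip winds around a punctured disc of area A. The result is injective once different turns
are disjoint, either in V or in the fibre.

If (N + 1)π < A, the target fibre has room for (N + 1)^m disjoint unit positions, and a Gray code
(`exists_lattice_path`) visits them all by unit moves, one position per turn. While the fibre rests,
the strip can have almost the full height A. A unit move during a θ-interval of length η spreads V
by about π/η. With η close to 2π/A this is half the annulus, so consecutive moves use alternate
halves, while moves at least two turns apart follow disjoint edges of the lattice. A turn therefore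
contains area about (1 - η)A = A - 2π, and the two ends, where nothing moves, supply another 2π.

This construction (`exists_isWrappingProfile`, `symplecticallyEmbeds_of_lt`) needs (N + 1)π < A and
a - 2π < (N + 1)^m (A - 2π). With N the fold number, `sPC` is the larger of the two resulting lower
bounds for A (`sPC_add_bounds`). The formula for n = 2 is algebra. -/

/-! ### Symplectic maps between open sets. -/

/-- `φ` is smooth on `U` and pulls the standard symplectic form back to itself there. -/
structure IsSymplecticOn {n : ℕ} (φ : (Fin n → ℂ) → (Fin n → ℂ)) (U : Set (Fin n → ℂ)) :
    Prop where
  contDiffOn : ContDiffOn ℝ ∞ φ U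
  pullback_eq : ∀ z ∈ U, ∀ u v : Fin n → ℂ,
    stdSymplecticForm (fderiv ℝ φ z u) (fderiv ℝ φ z v) = stdSymplecticForm u v

/-- A vector that is `ω₀`-orthogonal to everything vanishes. -/
theorem eq_zero_of_stdSymplecticForm {n : ℕ} (u : Fin n → ℂ)
    (h : ∀ v, stdSymplecticForm u v = 0) : u = 0 := by
  funext i
  have h1 := h (Pi.single i 1)
  have h2 := h (Pi.single i Complex.I)
  simp only [stdSymplecticForm] at h1 h2
  rw [Finset.sum_eq_single i (by intro j _ hj; simp [Pi.single_eq_of_ne hj]) (by simp)] at h1 h2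
  simp only [Pi.single_eq_same, Complex.one_re, Complex.one_im, Complex.I_re, Complex.I_im] at h1 h2
  apply Complex.ext <;> simp <;> linarith

theorem stdSymplecticForm_zero_left {n : ℕ} (v : Fin n → ℂ) :
    stdSymplecticForm (0 : Fin n → ℂ) v = 0 := by
  simp [stdSymplecticForm]

theorem IsSymplecticOn.differentiableAt {n : ℕ} {φ : (Fin n → ℂ) → (Fin n → ℂ)}
    {U : Set (Fin n → ℂ)} (h : IsSymplecticOn φ U) (hU : IsOpen U) {z : Fin n → ℂ} (hz : z ∈ U) :
    DifferentiableAt ℝ φ z :=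
  (h.contDiffOn.contDiffAt (hU.mem_nhds hz)).differentiableAt (by simp)

theorem IsSymplecticOn.comp {n : ℕ} {φ ψ : (Fin n → ℂ) → (Fin n → ℂ)} {U V : Set (Fin n → ℂ)}
    (hψ : IsSymplecticOn ψ V) (hφ : IsSymplecticOn φ U) (hV : IsOpen V) (hU : IsOpen U)
    (hm : MapsTo φ U V) : IsSymplecticOn (ψ ∘ φ) U where
  contDiffOn := hψ.contDiffOn.comp hφ.contDiffOn hm
  pullback_eq z hz u v := by
    rw [fderiv_comp z (hψ.differentiableAt hV (hm hz)) (hφ.differentiableAt hU hz)]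
    simp only [ContinuousLinearMap.comp_apply]
    rw [hψ.pullback_eq _ (hm hz), hφ.pullback_eq _ hz]

/-- An injective symplectic map on an open set is an embedding. -/
theorem IsSymplecticOn.isSymplecticEmbeddingOn {n : ℕ} {φ : (Fin n → ℂ) → (Fin n → ℂ)}
    {U : Set (Fin n → ℂ)} (h : IsSymplecticOn φ U) (hU : IsOpen U) (hi : InjOn φ U) :
    IsSymplecticEmbeddingOn φ U where
  contDiffOn := h.contDiffOn
  pullback_eq := h.pullback_eq
  isEmbedding := by
    have hopen : IsOpenMap (U.domRestrict φ) := by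
      rw [isOpenMap_iff_nhds_le]
      rintro ⟨z, hz⟩
      have hc := h.contDiffOn.contDiffAt (hU.mem_nhds hz)
      have hs : HasStrictFDerivAt φ (fderiv ℝ φ z) z := hc.hasStrictFDerivAt (by simp)
      -- Nondegeneracy of ω₀ makes the differential injective, hence surjective in equal dimensions,
      -- and a map with surjective strict derivative is locally open.
      have hker : LinearMap.ker (fderiv ℝ φ z : (Fin n → ℂ) →ₗ[ℝ] (Fin n → ℂ)) = ⊥ := by
        rw [LinearMap.ker_eq_bot']
        intro u hu
        refine eq_zero_of_stdSymplecticForm u fun v => ?_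
        rw [← h.pullback_eq z hz u v]
        have : fderiv ℝ φ z u = 0 := hu
        rw [this, stdSymplecticForm_zero_left]
      have hrange : (fderiv ℝ φ z).range = ⊤ := 
        LinearMap.ker_eq_bot_iff_range_eq_top.1 hker
      have := hs.map_nhds_eq_of_surj hrange
      change _ ≤ Filter.map (φ ∘ Subtype.val) _
      rw [← Filter.map_map, nhds_subtype_eq_comap, Filter.map_comap_of_mem, this]
      · rfl
      · rw [Subtype.range_coe]; exact hU.mem_nhds hz
    exact (Topology.IsOpenEmbedding.of_continuous_injective_isOpenMap
      (continuousOn_iff_continuous_domRestrict.1 h.contDiffOn.continuousOn)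
      (injOn_iff_injective.1 hi) hopen).isEmbedding

/-! ### Area preserving maps of the plane. -/

/-- The standard area form on `ℂ`. -/
def areaForm (u v : ℂ) : ℝ := u.re * v.im - u.im * v.re

/-- `φ` is smooth and area preserving on `U ⊆ ℂ`. -/
structure IsAreaPreservingOn (φ : ℂ → ℂ) (U : Set ℂ) : Prop where
  contDiffOn : ContDiffOn ℝ ∞ φ U
  pullback_eq : ∀ z ∈ U, ∀ u v : ℂ, areaForm (fderiv ℝ φ z u) (fderiv ℝ φ z v) = areaForm u v

theorem IsAreaPreservingOn.differentiableAt {φ : ℂ → ℂ}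
    {U : Set ℂ} (h : IsAreaPreservingOn φ U) (hU : IsOpen U) {z : ℂ} (hz : z ∈ U) :
    DifferentiableAt ℝ φ z :=
  (h.contDiffOn.contDiffAt (hU.mem_nhds hz)).differentiableAt (by simp)

theorem IsAreaPreservingOn.comp {φ ψ : ℂ → ℂ} {U V : Set ℂ}
    (hψ : IsAreaPreservingOn ψ V) (hφ : IsAreaPreservingOn φ U) (hV : IsOpen V) (hU : IsOpen U)
    (hm : MapsTo φ U V) : IsAreaPreservingOn (ψ ∘ φ) U where
  contDiffOn := hψ.contDiffOn.comp hφ.contDiffOn hm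
  pullback_eq z hz u v := by
    rw [fderiv_comp z (hψ.differentiableAt hV (hm hz)) (hφ.differentiableAt hU hz)]
    simp only [ContinuousLinearMap.comp_apply]
    rw [hψ.pullback_eq _ (hm hz), hφ.pullback_eq _ hz]

/-- A product of area preserving maps is symplectic. -/
theorem isSymplecticOn_pi {n : ℕ} {φ : Fin n → ℂ → ℂ} {U : Fin n → Set ℂ}
    (h : ∀ i, IsAreaPreservingOn (φ i) (U i)) (hU : ∀ i, IsOpen (U i)) :
    IsSymplecticOn (fun z i => φ i (z i)) {z | ∀ i, z i ∈ U i} where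
  contDiffOn := contDiffOn_pi.2 fun i =>
    (h i).contDiffOn.comp (contDiff_apply ℝ ℂ i).contDiffOn fun _ hz => hz i
  pullback_eq z hz u v := by
    have hd : HasFDerivAt (fun z : Fin n → ℂ => fun i => φ i (z i))
        (ContinuousLinearMap.pi fun i => (fderiv ℝ (φ i) (z i)).comp
          (ContinuousLinearMap.proj i)) z := by
      rw [hasFDerivAt_pi]
      intro i
      exact ((h i).differentiableAt (hU i) (hz i)).hasFDerivAt.comp z
        (ContinuousLinearMap.proj (R := ℝ) (φ := fun _ : Fin n => ℂ) i).hasFDerivAt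
    rw [hd.fderiv]
    simp only [stdSymplecticForm]
    exact Finset.sum_congr rfl fun i _ => (h i).pullback_eq (z i) (hz i) (u i) (v i)

theorem IsOpen.setOf_forall_mem {n : ℕ} {U : Fin n → Set ℂ} (hU : ∀ i, IsOpen (U i)) :
    IsOpen {z : Fin n → ℂ | ∀ i, z i ∈ U i} := by
  simp only [Set.ofPred_forall]
  exact isOpen_iInter_of_finite fun i => (hU i).preimage (continuous_apply i)

/-- A map of the plane whose real and imaginary parts `P`, `Q` satisfy `dP ∧ dQ = dx ∧ dy`. -/
theorem isAreaPreservingOn_mk {P Q : ℂ → ℝ} {P' Q' : ℂ → ℂ →L[ℝ] ℝ} {U : Set ℂ}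
    (hP : ContDiffOn ℝ ∞ P U) (hQ : ContDiffOn ℝ ∞ Q U)
    (hP' : ∀ z ∈ U, HasFDerivAt P (P' z) z) (hQ' : ∀ z ∈ U, HasFDerivAt Q (Q' z) z)
    (h : ∀ z ∈ U, ∀ u v, P' z u * Q' z v - Q' z u * P' z v = areaForm u v) :
    IsAreaPreservingOn (fun z => (⟨P z, Q z⟩ : ℂ)) U where
  contDiffOn := Complex.equivRealProdCLM.symm.contDiff.comp_contDiffOn (hP.prodMk hQ)
  pullback_eq z hz u v := by
    have hd : HasFDerivAt (fun z => (⟨P z, Q z⟩ : ℂ))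
        ((Complex.equivRealProdCLM.symm : ℝ × ℝ →L[ℝ] ℂ).comp ((P' z).prod (Q' z))) z :=
      (Complex.equivRealProdCLM.symm : ℝ × ℝ →L[ℝ] ℂ).hasFDerivAt.comp z
        ((hP' z hz).prodMk (hQ' z hz))
    rw [hd.fderiv, ← h z hz u v]
    rfl

/-- The map `(x, y) ↦ (F x, y / F' x)`. -/
noncomputable def stretch (F F' : ℝ → ℝ) (z : ℂ) : ℂ := ⟨F z.re, z.im / F' z.re⟩

/-- The differential is triangular with diagonal entries `F'` and `1 / F'`, so its determinant is
one whatever the off-diagonal entry. -/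
theorem isAreaPreservingOn_stretch {F F' : ℝ → ℝ} {I : Set ℝ} (hI : IsOpen I)
    (hF : ContDiffOn ℝ ∞ F I) (hF' : ContDiffOn ℝ ∞ F' I) (hd : ∀ x ∈ I, HasDerivAt F (F' x) x)
    (h0 : ∀ x ∈ I, F' x ≠ 0) : IsAreaPreservingOn (stretch F F') {z | z.re ∈ I} := by
  have hre : ContDiffOn ℝ ∞ Complex.re {z : ℂ | z.re ∈ I} := Complex.reCLM.contDiff.contDiffOn
  have him : ContDiffOn ℝ ∞ Complex.im {z : ℂ | z.re ∈ I} := Complex.imCLM.contDiff.contDiffOn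
  refine isAreaPreservingOn_mk (P' := fun z => F' z.re • Complex.reCLM)
    (Q' := fun z => z.im • ((-(deriv F' z.re) / (F' z.re) ^ 2) • Complex.reCLM) +
      (F' z.re)⁻¹ • Complex.imCLM)
    (hF.comp hre fun _ h => h) (him.div (hF'.comp hre fun _ h => h) fun z hz => h0 _ hz) ?_ ?_ ?_
  · intro z hz
    exact (hd z.re hz).comp_hasFDerivAt z Complex.reCLM.hasFDerivAt
  · intro z hz
    have h1 : HasDerivAt F' (deriv F' z.re) z.re :=
      ((hF'.contDiffAt (hI.mem_nhds hz)).differentiableAt (by simp)).hasDerivAt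
    have h2 := (h1.inv (h0 _ hz)).comp_hasFDerivAt z Complex.reCLM.hasFDerivAt
    have h3 := (Complex.imCLM.hasFDerivAt (x := z)).mul h2
    simpa only [div_eq_mul_inv] using! h3
  · intro z hz u v
    have := h0 _ hz
    simp [areaForm]
    field_simp
    ring

/-- Inverse functions of smooth functions of one variable with nonvanishing derivative. -/
theorem contDiffOn_of_rightInverse {F F' G : ℝ → ℝ} {I J : Set ℝ} (hI : IsOpen I)
    (hF : ContDiffOn ℝ ∞ F I) (hd : ∀ x ∈ I, HasDerivAt F (F' x) x) (h0 : ∀ x ∈ I, F' x ≠ 0)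
    (hinj : InjOn F I) (hG : MapsTo G J I) (hFG : ∀ y ∈ J, F (G y) = y) (hJ : IsOpen J) :
    ContDiffOn ℝ ∞ G J ∧ ∀ y ∈ J, HasDerivAt G (F' (G y))⁻¹ y := by
  have hc : ∀ y ∈ J, ContDiffAt ℝ ∞ G y := by
    intro y hy
    have hx := hG hy
    have hcF := hF.contDiffAt (hI.mem_nhds hx)
    have hd' : HasFDerivAt F ((ContinuousLinearEquiv.unitsEquivAut ℝ
        (Units.mk0 _ (h0 _ hx)) : ℝ ≃L[ℝ] ℝ) : ℝ →L[ℝ] ℝ) (G y) :=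
      (hd _ hx).hasFDerivAt_equiv (h0 _ hx)
    -- No continuity of `G` is assumed: injectivity of `F` on `I` forces `G` to agree near y with
    -- the smooth local inverse.
    have hl := hcF.to_localInverse hd' (by simp)
    rw [hFG y hy] at hl
    refine hl.congr_of_eventuallyEq ?_
    have hs := hcF.hasStrictFDerivAt' hd' (by simp)
    have h1 := hs.eventually_right_inverse
    have h2 := hs.localInverse_tendsto (hI.mem_nhds hx)
    rw [hFG y hy] at h1 h2
    filter_upwards [h1, h2, hJ.mem_nhds hy] with t ht1 ht2 ht3
    exact hinj (hG ht3) ht2 ((hFG t ht3).trans ht1.symm)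
  refine ⟨fun y hy => (hc y hy).contDiffWithinAt, fun y hy => ?_⟩
  refine HasDerivAt.of_local_left_inverse (hc y hy).continuousAt (hd _ (hG hy)) (h0 _ (hG hy)) ?_
  filter_upwards [hJ.mem_nhds hy] with t ht using hFG t ht

/-! ### Areas of vertical slices of a disc. -/

/-- Twice the height of the half disc of radius `r`. -/
noncomputable def discWidth (r x : ℝ) : ℝ := 2 * √(r ^ 2 - x ^ 2)

/-- The area of the part of the disc of radius `r` between the vertical lines through `0`
and `x`. -/
noncomputable def discArea (r x : ℝ) : ℝ := r ^ 2 * Real.arcsin (x / r) + x * √(r ^ 2 - x ^ 2)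

theorem sq_sub_sq_pos_of_mem {r x : ℝ} (hx : x ∈ Ioo (-r) r) : 0 < r ^ 2 - x ^ 2 := by
  nlinarith [hx.1, hx.2]

theorem discWidth_pos {r x : ℝ} (hx : x ∈ Ioo (-r) r) : 0 < discWidth r x :=
  mul_pos two_pos (Real.sqrt_pos.2 (sq_sub_sq_pos_of_mem hx))

theorem contDiffOn_discWidth (r : ℝ) : ContDiffOn ℝ ∞ (discWidth r) (Ioo (-r) r) :=
  contDiffOn_const.mul (ContDiffOn.sqrt (by fun_prop) fun _ hx => (sq_sub_sq_pos_of_mem hx).ne')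

theorem div_mem_of_mem {r x : ℝ} (hr : 0 < r) (hx : x ∈ Ioo (-r) r) : x / r ∈ Ioo (-1) (1 : ℝ) :=
  ⟨by rw [lt_div_iff₀ hr]; linarith [hx.1], by rw [div_lt_iff₀ hr]; linarith [hx.2]⟩

theorem contDiffOn_discArea {r : ℝ} (hr : 0 < r) :
    ContDiffOn ℝ ∞ (discArea r) (Ioo (-r) r) := by
  intro x hx
  have h1 := div_mem_of_mem hr hx
  have h2 : ContDiffAt ℝ ∞ (fun x => √(r ^ 2 - x ^ 2)) x :=
    ContDiffAt.sqrt (by fun_prop) (sq_sub_sq_pos_of_mem hx).ne'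
  have h3 : ContDiffAt ℝ ∞ (fun x => Real.arcsin (x / r)) x :=
    (Real.contDiffAt_arcsin (by linarith [h1.1]) (by linarith [h1.2])).comp x (by fun_prop)
  exact ((contDiffAt_const.mul h3).add (contDiffAt_id.mul h2)).contDiffWithinAt

theorem hasDerivAt_discArea {r x : ℝ} (hr : 0 < r) (hx : x ∈ Ioo (-r) r) :
    HasDerivAt (discArea r) (discWidth r x) x := by
  have h1 := div_mem_of_mem hr hx
  have hp := sq_sub_sq_pos_of_mem hx
  have h2 : HasDerivAt (fun x => √(r ^ 2 - x ^ 2)) (-(2 * x) / (2 * √(r ^ 2 - x ^ 2))) x := by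
    refine HasDerivAt.sqrt ?_ hp.ne'
    simpa using (hasDerivAt_pow 2 x).const_sub (r ^ 2)
  have h3 : HasDerivAt (fun x => Real.arcsin (x / r)) (1 / √(1 - (x / r) ^ 2) * (1 / r)) x :=
    (Real.hasDerivAt_arcsin (by linarith [h1.1]) (by linarith [h1.2])).comp x
      ((hasDerivAt_id x).div_const r)
  have h4 : √(1 - (x / r) ^ 2) = √(r ^ 2 - x ^ 2) / r := by
    rw [show 1 - (x / r) ^ 2 = (r ^ 2 - x ^ 2) / r ^ 2 by field_simp, Real.sqrt_div hp.le,
      Real.sqrt_sq hr.le]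
  have h5 := (h3.const_mul (r ^ 2)).add ((hasDerivAt_id x).mul h2)
  convert! h5 using 1
  have hs := Real.sqrt_pos.2 hp
  have hss := Real.sq_sqrt hp.le
  rw [h4, discWidth]
  simp only [id]
  field_simp
  rw [hss]
  ring

theorem strictMonoOn_discArea {r : ℝ} (hr : 0 < r) :
    StrictMonoOn (discArea r) (Icc (-r) r) := by
  refine strictMonoOn_of_deriv_pos (convex_Icc _ _) ?_ ?_
  · exact Continuous.continuousOn (by unfold discArea; fun_prop)
  · intro x hx
    rw [interior_Icc] at hx
    rw [(hasDerivAt_discArea hr hx).deriv]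
    exact discWidth_pos hx

theorem discArea_self {r : ℝ} (hr : 0 < r) : discArea r r = Real.pi * r ^ 2 / 2 := by
  simp [discArea, hr.ne']; ring

theorem discArea_neg_self {r : ℝ} (hr : 0 < r) : discArea r (-r) = -(Real.pi * r ^ 2 / 2) := by
  simp [discArea, hr.ne']; ring

theorem abs_discArea_lt {r x : ℝ} (hr : 0 < r) (hx : x ∈ Ioo (-r) r) :
    |discArea r x| < Real.pi * r ^ 2 / 2 := by
  have hx' := Ioo_subset_Icc_self hx
  rw [abs_lt, ← discArea_self hr, discArea_self hr, ← discArea_neg_self hr]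
  refine ⟨strictMonoOn_discArea hr ⟨le_rfl, by linarith⟩ hx' hx.1, ?_⟩
  rw [← discArea_self hr]
  exact strictMonoOn_discArea hr hx' ⟨by linarith, le_rfl⟩ hx.2

/-- The inverse function of `discArea`. -/
theorem exists_inverse_discArea {r : ℝ} (hr : 0 < r) : ∃ G : ℝ → ℝ,
    MapsTo G (Ioo (-(Real.pi * r ^ 2 / 2)) (Real.pi * r ^ 2 / 2)) (Ioo (-r) r) ∧
    ∀ y ∈ Ioo (-(Real.pi * r ^ 2 / 2)) (Real.pi * r ^ 2 / 2), discArea r (G y) = y := by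
  have : ∀ y : ℝ, ∃ x, y ∈ Ioo (-(Real.pi * r ^ 2 / 2)) (Real.pi * r ^ 2 / 2) →
      x ∈ Ioo (-r) r ∧ discArea r x = y := by
    intro y
    by_cases hy : y ∈ Ioo (-(Real.pi * r ^ 2 / 2)) (Real.pi * r ^ 2 / 2)
    · rw [← discArea_self hr, discArea_self hr, ← discArea_neg_self hr, ← discArea_self hr] at hy
      have hcont : Continuous (discArea r) := by unfold discArea; fun_prop
      obtain ⟨x, hx, rfl⟩ := intermediate_value_Ioo (by linarith : -r ≤ r) hcont.continuousOn hy
      exact ⟨x, fun _ => ⟨hx, rfl⟩⟩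
    · exact ⟨0, fun h => absurd h hy⟩
  choose G hG using this
  exact ⟨G, fun y hy => (hG y hy).1, fun y hy => (hG y hy).2⟩

/-! ### Wrapping a strip around a punctured disc. -/

/-- Symplectic polar coordinates on the disc of area `A`, wrapping the strip
`|y| < A / 2` around the punctured disc. -/
noncomputable def wrap (A : ℝ) (z : ℂ) : ℂ :=
  ⟨√((z.im + A / 2) / Real.pi) * Real.cos (2 * Real.pi * z.re),
    -(√((z.im + A / 2) / Real.pi) * Real.sin (2 * Real.pi * z.re))⟩

/-- The squared radius is affine in the imaginary part with slope 1/π, which cancels the angular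
speed 2π. The radius grows with the second coordinate, so the angle must run backwards to preserve
orientation; hence the minus sign on the sine. -/
theorem isAreaPreservingOn_wrap (A : ℝ) :
    IsAreaPreservingOn (wrap A) {z | z.im ∈ Ioo (-(A / 2)) (A / 2)} := by
  have hpi := Real.pi_pos
  have hpos : ∀ z ∈ {z : ℂ | z.im ∈ Ioo (-(A / 2)) (A / 2)},
      0 < (z.im + A / 2) / Real.pi := fun z hz => div_pos (by linarith [hz.1]) hpi
  have him : ContDiff ℝ ∞ Complex.im := Complex.imCLM.contDiff
  have hre : ContDiff ℝ ∞ Complex.re := Complex.reCLM.contDiff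
  have hR : ContDiffOn ℝ ∞ (fun z : ℂ => √((z.im + A / 2) / Real.pi))
      {z | z.im ∈ Ioo (-(A / 2)) (A / 2)} :=
    ContDiffOn.sqrt ((him.add contDiff_const).div_const _).contDiffOn fun z hz => (hpos z hz).ne'
  have hR' : ∀ z ∈ {z : ℂ | z.im ∈ Ioo (-(A / 2)) (A / 2)},
      HasFDerivAt (fun z : ℂ => √((z.im + A / 2) / Real.pi))
        ((1 / (2 * √((z.im + A / 2) / Real.pi))) • Real.pi⁻¹ • Complex.imCLM) z := by
    intro z hz
    refine HasFDerivAt.sqrt ?_ (hpos z hz).ne'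
    simp only [div_eq_inv_mul _ Real.pi]
    exact (Complex.imCLM.hasFDerivAt.add_const (A / 2)).const_mul _
  have hphi : ∀ z : ℂ, HasFDerivAt (fun z : ℂ => 2 * Real.pi * z.re)
      ((2 * Real.pi) • Complex.reCLM) z := fun z => Complex.reCLM.hasFDerivAt.const_mul _
  refine isAreaPreservingOn_mk
    (hR.mul (Real.contDiff_cos.comp (contDiff_const.mul hre)).contDiffOn)
    (hR.mul (Real.contDiff_sin.comp (contDiff_const.mul hre)).contDiffOn).neg
    (fun z hz => (hR' z hz).mul (hphi z).cos) (fun z hz => ((hR' z hz).mul (hphi z).sin).neg) ?_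
  intro z hz u v
  have hs := Real.sqrt_pos.2 (hpos z hz)
  have hcs := Real.cos_sq_add_sin_sq (2 * Real.pi * z.re)
  generalize √((z.im + A / 2) / Real.pi) = R at hs ⊢
  simp [areaForm]
  field_simp
  linear_combination (4 * R ^ 2 * Real.pi ^ 2) * (u.re * v.im - u.im * v.re) * hcs

theorem normSq_wrap {A : ℝ} {z : ℂ} (hz : z.im ∈ Ioo (-(A / 2)) (A / 2)) :
    Real.pi * ‖wrap A z‖ ^ 2 = z.im + A / 2 := by
  have hpos : 0 ≤ (z.im + A / 2) / Real.pi := div_nonneg (by linarith [hz.1]) Real.pi_pos.le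
  have hpi := Real.pi_ne_zero
  rw [← Complex.normSq_eq_norm_sq, Complex.normSq_apply]
  simp only [wrap]
  have hs := Real.sq_sqrt hpos
  have hcs := Real.cos_sq_add_sin_sq (2 * Real.pi * z.re)
  calc _ = Real.pi * (√((z.im + A / 2) / Real.pi) ^ 2 *
        (Real.cos (2 * Real.pi * z.re) ^ 2 + Real.sin (2 * Real.pi * z.re) ^ 2)) := by ring
    _ = _ := by rw [hs, hcs]; field_simp

theorem wrap_eq_iff {A : ℝ} {z w : ℂ} (hz : z.im ∈ Ioo (-(A / 2)) (A / 2))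
    (hw : w.im ∈ Ioo (-(A / 2)) (A / 2)) (h : wrap A z = wrap A w) :
    z.im = w.im ∧ ∃ k : ℤ, w.re = z.re + k := by
  have him : z.im = w.im := by
    have h1 := normSq_wrap hz
    rw [h, normSq_wrap hw] at h1
    linarith
  refine ⟨him, ?_⟩
  have hpos : 0 < √((w.im + A / 2) / Real.pi) :=
    Real.sqrt_pos.2 (div_pos (by linarith [hw.1]) Real.pi_pos)
  have hre := congrArg Complex.re h
  have him' := congrArg Complex.im h
  simp only [wrap, him] at hre him'
  have hc := mul_left_cancel₀ hpos.ne' hre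
  have hs := mul_left_cancel₀ hpos.ne' (neg_injective him')
  obtain ⟨k, hk⟩ := (Real.Angle.cos_sin_inj hc hs |> Real.Angle.angle_eq_iff_two_pi_dvd_sub.1)
  refine ⟨-k, ?_⟩
  have hpi := Real.pi_pos
  push_cast
  have : 2 * Real.pi * (z.re - w.re) = 2 * Real.pi * k := by linarith
  have := mul_left_cancel₀ (by positivity) this
  linarith

/-! ### Smooth steps with slope close to one. -/

/-- `f` is a smooth step of height one over an interval of length one, with slope `g ≤ e`. -/
structure IsSmoothStep (e : ℝ) (f g : ℝ → ℝ) : Prop where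
  contDiff : ContDiff ℝ ∞ f
  contDiff_slope : ContDiff ℝ ∞ g
  hasDerivAt : ∀ t, HasDerivAt f (g t) t
  slope_nonneg : ∀ t, 0 ≤ g t
  slope_le : ∀ t, g t ≤ e
  slope_eq_zero : ∀ t, 1 / 2 ≤ |t| → g t = 0
  eq_zero : ∀ t, t ≤ -(1 / 2) → f t = 0
  eq_one : ∀ t, 1 / 2 ≤ t → f t = 1

theorem IsSmoothStep.mem_Icc {e : ℝ} {f g : ℝ → ℝ} (h : IsSmoothStep e f g) (t : ℝ) :
    f t ∈ Icc (0 : ℝ) 1 := by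
  have hm : Monotone f := monotone_of_hasDerivAt_nonneg h.hasDerivAt h.slope_nonneg
  constructor
  · rw [← h.eq_zero (min t (-(1 / 2))) (min_le_right _ _)]
    exact hm (min_le_left _ _)
  · rw [← h.eq_one (max t (1 / 2)) (le_max_right _ _)]
    exact hm (le_max_left _ _)

theorem exists_isSmoothStep {e : ℝ} (he : 1 < e) : ∃ f g : ℝ → ℝ, IsSmoothStep e f g := by
  have he0 : 0 < e := by linarith
  -- The plateau has length 1/e, so the normalised bump is bounded by e.
  let b : ContDiffBump (0 : ℝ) := ⟨1 / (2 * e), 1 / 2, by positivity, by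
    rw [div_lt_div_iff₀ (by positivity) (by norm_num)]; linarith⟩
  let g : ℝ → ℝ := b.normed MeasureTheory.volume
  have hg : ContDiff ℝ ∞ g := b.contDiff_normed
  have hg0 : ∀ t, 1 / 2 ≤ |t| → g t = 0 := by
    intro t ht
    have : t ∉ Function.support g := by
      rw [b.support_normed_eq]
      simpa [b] using ht
    simpa using this
  have hd : ∀ t, HasDerivAt (fun t => ∫ x in (-(1 / 2))..t, g x) (g t) t := fun t =>
    (hg.continuous.integral_hasStrictDerivAt _ t).hasDerivAt
  have h1 : ∫ x in (-(1 / 2) : ℝ)..(1 / 2), g x = 1 := by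
    refine (intervalIntegral.integral_eq_integral_of_support_subset ?_).trans
      (b.integral_normed (μ := MeasureTheory.volume))
    rw [b.support_normed_eq, Real.ball_eq_Ioo]
    simpa [b] using (Ioo_subset_Ioc_self : Ioo (-(1 / 2) : ℝ) (1 / 2) ⊆ _)
  refine ⟨fun t => ∫ x in (-(1 / 2))..t, g x, g, ?_, hg, hd, fun t => b.nonneg_normed t, ?_, hg0,
    ?_, ?_⟩
  · rw [contDiff_infty_iff_deriv]
    refine ⟨fun t => (hd t).differentiableAt, ?_⟩
    rwa [show deriv (fun t => ∫ x in (-(1 / 2))..t, g x) = g from funext fun t => (hd t).deriv]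
  · intro t
    refine (b.normed_le_div_measure_closedBall_rIn MeasureTheory.volume t).trans ?_
    simp [MeasureTheory.measureReal_def, Real.volume_closedBall, b]
    rw [ENNReal.toReal_ofReal (by positivity)]
    field_simp
    rfl
  · intro t ht
    rw [intervalIntegral.integral_symm, neg_eq_zero]
    refine intervalIntegral.integral_zero_ae (Filter.Eventually.of_forall fun x hx => hg0 x ?_)
    rw [uIoc_of_le ht] at hx
    rw [le_abs]; right; linarith [hx.2]
  · intro t ht
    rw [← intervalIntegral.integral_add_adjacent_intervals (b := 1 / 2)
      (hg.continuous.intervalIntegrable _ _) (hg.continuous.intervalIntegrable _ _), h1,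
      add_eq_left]
    refine intervalIntegral.integral_zero_ae (Filter.Eventually.of_forall fun x hx => hg0 x ?_)
    rw [uIoc_of_le ht] at hx
    rw [le_abs]; left; exact hx.1.le

/-! ### Lattice paths through a cube. -/

/-- The reflected Gray code: a path through all lattice points of the cube `{0, …, N}ᵐ`. -/
theorem exists_lattice_path (N m : ℕ) : ∃ p : ℕ → Fin m → ℤ,
    (∀ k < (N + 1) ^ m, ∀ i, 0 ≤ p k i ∧ p k i ≤ N) ∧
    (∀ k < (N + 1) ^ m, ∀ l < (N + 1) ^ m, p k = p l → k = l) ∧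
    ∀ k, k + 1 < (N + 1) ^ m → ∑ i, |p (k + 1) i - p k i| ≤ 1 := by
  induction m with
  | zero => exact ⟨fun _ i => i.elim0, fun _ _ i => i.elim0, by simp, by simp⟩
  | succ m ih =>
    obtain ⟨p, hp, hinj, hstep⟩ := ih
    set B := (N + 1) ^ m with hB
    have hB0 : 0 < B := by positivity
    have hBs : (N + 1) ^ (m + 1) = B * (N + 1) := pow_succ _ _
    -- Each layer of the new coordinate repeats the lower-dimensional path, alternately forwards and
    -- backwards, so only the new coordinate changes between layers.
    let ρ : ℕ → ℕ := fun k => if Even (k / B) then k % B else B - 1 - k % B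
    have hρ : ∀ k, ρ k < B := by
      intro k
      have := Nat.mod_lt k hB0
      dsimp only [ρ]; split_ifs <;> omega
    refine ⟨fun k => Fin.cons ((k / B : ℕ) : ℤ) (p (ρ k)), ?_, ?_, ?_⟩
    · intro k hk i
      rw [hBs] at hk
      have : k / B < N + 1 := Nat.div_lt_of_lt_mul hk
      refine Fin.cases ?_ (fun i => ?_) i
      · simp only [Fin.cons_zero]
        exact ⟨Int.natCast_nonneg _, by exact_mod_cast Nat.lt_succ_iff.1 this⟩
      · simpa using hp _ (hρ k) i
    · intro k _ l _ h
      obtain ⟨h1, h2⟩ := Fin.cons_inj.1 h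
      have h1 : k / B = l / B := by exact_mod_cast h1
      have h3 := hinj _ (hρ k) _ (hρ l) h2
      have hk := Nat.mod_lt k hB0
      have hl := Nat.mod_lt l hB0
      have h4 : k % B = l % B := by
        simp only [ρ, h1] at h3
        split_ifs at h3 <;> omega
      rw [← Nat.div_add_mod k B, ← Nat.div_add_mod l B, h1, h4]
    · intro k hk
      simp only [Fin.sum_univ_succ, Fin.cons_zero, Fin.cons_succ]
      have hkm := Nat.mod_lt k hB0
      rcases Nat.lt_or_ge (k % B + 1) B with h | h
      · have h1 : (k + 1) / B = k / B := by
          rw [← Nat.div_add_mod k B, add_assoc, Nat.mul_add_div hB0, Nat.mul_add_div hB0,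
            Nat.div_eq_of_lt h, Nat.div_eq_of_lt hkm]
        have h2 : (k + 1) % B = k % B + 1 := by
          rw [← Nat.div_add_mod k B, add_assoc, Nat.mul_add_mod, Nat.mod_eq_of_lt h,
            Nat.mul_add_mod, Nat.mod_eq_of_lt hkm]
        rw [h1, sub_self, abs_zero, zero_add]
        simp only [ρ, h1, h2]
        split_ifs with hev
        · exact hstep _ h
        · obtain ⟨s, hs⟩ : ∃ s, s = B - 1 - (k % B + 1) := ⟨_, rfl⟩
          rw [← hs, show B - 1 - k % B = s + 1 by omega]
          simp only [abs_sub_comm (p s _)]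
          exact hstep s (by omega)
      · have h0 : k % B + 1 = B := by omega
        have h1 : (k + 1) / B = k / B + 1 := by
          rw [← Nat.div_add_mod k B, add_assoc, h0, Nat.mul_add_div hB0, Nat.mul_add_div hB0,
            Nat.div_self hB0, Nat.div_eq_of_lt hkm]
        have h2 : (k + 1) % B = 0 := by
          rw [← Nat.div_add_mod k B, add_assoc, h0, Nat.mul_add_mod, Nat.mod_self]
        have h3 : ρ (k + 1) = ρ k := by
          simp only [ρ, h1, h2, Nat.even_add_one]
          split_ifs <;> omega
        simp [h3, h1]

/-- The lattice path with its first and last points repeated. -/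
theorem exists_lattice_path_extended (N m : ℕ) : ∃ P : ℕ → Fin m → ℤ,
    (∀ k i, 0 ≤ P k i ∧ P k i ≤ N) ∧ (∀ k, ∑ i, |P (k + 1) i - P k i| ≤ 1) ∧
    P 1 = P 0 ∧ P ((N + 1) ^ m + 1) = P ((N + 1) ^ m) ∧
    ∀ k, k + 2 ≤ (N + 1) ^ m → ∀ j ≤ k + 1, ∀ l, k + 2 ≤ l → P j ≠ P l := by
  obtain ⟨p, hp, hinj, hstep⟩ := exists_lattice_path N m
  have hM : 0 < (N + 1) ^ m := by positivity
  generalize (N + 1) ^ m = M at *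
  -- Truncated subtraction sends both 0 and 1 to the first point, and the minimum keeps every index
  -- from M on at the last one.
  refine ⟨fun j => p (min (j - 1) (M - 1)), fun k => hp _ (by omega), ?_, by simp, ?_, ?_⟩
  · intro k
    beta_reduce
    by_cases h : min (k + 1 - 1) (M - 1) = min (k - 1) (M - 1)
    · rw [h]; simp
    · rw [show min (k + 1 - 1) (M - 1) = min (k - 1) (M - 1) + 1 by omega]
      exact hstep _ (by omega)
  · beta_reduce
    rw [show min (M + 1 - 1) (M - 1) = min (M - 1) (M - 1) by omega]
  · intro k hk j hj l hl h
    have h : min (j - 1) (M - 1) = min (l - 1) (M - 1) := hinj _ (by omega) _ (by omega) h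
    omega

/-- An edge of the lattice fills its own bounding box: at most one coordinate varies, and it varies
by at most one. -/
theorem exists_eq_of_sum_abs_le_one {m : ℕ} {p q c : Fin m → ℤ} (h : ∑ i, |q i - p i| ≤ 1)
    (hc : ∀ i, min (p i) (q i) ≤ c i ∧ c i ≤ max (p i) (q i)) : c = p ∨ c = q := by
  by_contra! hne
  obtain ⟨i, hi⟩ := Function.ne_iff.1 hne.1
  obtain ⟨j, hj⟩ := Function.ne_iff.1 hne.2
  have hci := hc i
  have hcj := hc j
  by_cases hij : i = j
  · subst hij
    have : |q i - p i| ≤ 1 :=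
      (Finset.single_le_sum (f := fun i => |q i - p i|) (fun _ _ => abs_nonneg _)
        (Finset.mem_univ i)).trans h
    rw [abs_le] at this
    omega
  · have := (Finset.sum_le_univ_sum_of_nonneg (s := {i, j}) (f := fun i => |q i - p i|)
      (fun _ => abs_nonneg _)).trans h
    rw [Finset.sum_pair hij] at this
    have h1 : 1 ≤ |q i - p i| := by rw [le_abs]; omega
    have h2 : 1 ≤ |q j - p j| := by rw [le_abs]; omega
    omega

/-- Unit cubes moving along disjoint edges of the lattice have disjoint interiors. -/
theorem exists_one_le_abs_sub {m : ℕ} {p p' q q' : Fin m → ℤ} (hp : ∑ i, |p' i - p i| ≤ 1)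
    (hq : ∑ i, |q' i - q i| ≤ 1) (h1 : p ≠ q) (h2 : p ≠ q') (h3 : p' ≠ q) (h4 : p' ≠ q')
    {s t : ℝ} (hs : s ∈ Icc (0 : ℝ) 1) (ht : t ∈ Icc (0 : ℝ) 1) :
    ∃ i, 1 ≤ |(p i + (p' i - p i) * s : ℝ) - (q i + (q' i - q i) * t)| := by
  have key : ∀ (x y : ℤ) (r : ℝ), r ∈ Icc (0 : ℝ) 1 →
      ((min x y : ℤ) : ℝ) ≤ x + (y - x) * r ∧ x + (y - x) * r ≤ ((max x y : ℤ) : ℝ) := by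
    intro x y r hr
    obtain ⟨hr0, hr1⟩ := hr
    push_cast
    rcases le_total (x : ℝ) y with h | h
    · rw [min_eq_left h, max_eq_right h]; constructor <;> nlinarith
    · rw [min_eq_right h, max_eq_left h]; constructor <;> nlinarith
  by_contra! hcon
  -- If the moving cubes overlapped, the bounding boxes of the two edges would meet, since integers
  -- differing by less than one are equal. The coordinatewise maximum of the lower corners is then a
  -- lattice point of both boxes, hence a common endpoint.
  have hov : ∀ i, max (min (p i) (p' i)) (min (q i) (q' i)) ≤ max (p i) (p' i) ∧
      max (min (p i) (p' i)) (min (q i) (q' i)) ≤ max (q i) (q' i) := by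
    intro i
    have hi := abs_lt.1 (hcon i)
    obtain ⟨a1, a2⟩ := key (p i) (p' i) s hs
    obtain ⟨b1, b2⟩ := key (q i) (q' i) t ht
    have c1 : ((min (q i) (q' i) : ℤ) : ℝ) < ((max (p i) (p' i) + 1 : ℤ) : ℝ) := by
      push_cast at *; linarith [hi.1]
    have c2 : ((min (p i) (p' i) : ℤ) : ℝ) < ((max (q i) (q' i) + 1 : ℤ) : ℝ) := by
      push_cast at *; linarith [hi.2]
    have c1 := Int.cast_lt.1 c1
    have c2 := Int.cast_lt.1 c2
    omega
  rcases exists_eq_of_sum_abs_le_one hp (c := fun i => max (min (p i) (p' i)) (min (q i) (q' i)))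
    fun i => ⟨le_max_left _ _, (hov i).1⟩ with h | h <;>
  rcases exists_eq_of_sum_abs_le_one hq (c := fun i => max (min (p i) (p' i)) (min (q i) (q' i)))
    fun i => ⟨le_max_right _ _, (hov i).2⟩ with h' | h' <;>
  simp_all

/-! ### Staircases built from smooth steps. -/

/-- A sum of translates of `φ (· / η)`. -/
noncomputable def translateSum (L : ℕ) (c : ℕ → ℝ) (φ : ℝ → ℝ) (η s θ : ℝ) : ℝ :=
  ∑ j ∈ Finset.range L, c j * φ ((θ - j - s) / η)

theorem contDiff_translateSum (L : ℕ) (c : ℕ → ℝ) {φ : ℝ → ℝ} (hφ : ContDiff ℝ ∞ φ) (η s : ℝ) :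
    ContDiff ℝ ∞ (translateSum L c φ η s) :=
  ContDiff.sum fun _ _ => contDiff_const.mul (hφ.comp (by fun_prop))

theorem hasDerivAt_translateSum (L : ℕ) (c : ℕ → ℝ) {f g : ℝ → ℝ}
    (hf : ∀ t, HasDerivAt f (g t) t) (η s θ : ℝ) :
    HasDerivAt (translateSum L c f η s) (η⁻¹ * translateSum L c g η s θ) θ := by
  have h : ∀ j ∈ Finset.range L, HasDerivAt (fun θ => c j * f ((θ - j - s) / η))
      (c j * (g ((θ - j - s) / η) * (1 / η))) θ := fun j _ =>
    ((hf _).comp θ ((((hasDerivAt_id θ).sub_const _).sub_const _).div_const _)).const_mul _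
  have := HasDerivAt.fun_sum h
  convert! this using 1
  rw [translateSum, Finset.mul_sum]
  exact Finset.sum_congr rfl fun j _ => by ring

theorem translateSum_eq_single {L : ℕ} {e : ℝ} {f g : ℝ → ℝ} (h : IsSmoothStep e f g)
    (c : ℕ → ℝ) {η s θ : ℝ} {k : ℕ} (hη : 0 < η) (hk : k < L)
    (hθ : ∀ j : ℕ, j ≠ k → η / 2 ≤ |θ - j - s|) :
    translateSum L c g η s θ = c k * g ((θ - k - s) / η) := by
  refine Finset.sum_eq_single k (fun j _ hj => ?_) (by simp [hk])
  rw [h.slope_eq_zero, mul_zero]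
  rw [abs_div, abs_of_pos hη, le_div_iff₀ hη]
  linarith [hθ j hj]

theorem translateSum_eq_zero {L : ℕ} {e : ℝ} {f g : ℝ → ℝ} (h : IsSmoothStep e f g)
    (c : ℕ → ℝ) {η s θ : ℝ} (hη : 0 < η) (hθ : ∀ j : ℕ, η / 2 ≤ |θ - j - s|) :
    translateSum L c g η s θ = 0 := by
  refine Finset.sum_eq_zero fun j _ => ?_
  rw [h.slope_eq_zero, mul_zero]
  rw [abs_div, abs_of_pos hη, le_div_iff₀ hη]
  linarith [hθ j]

/-- Steps before the k-th are complete and telescope, and later ones have not begun. The staircase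
is thus on its way from `Q k` to `Q (k + 1)`. -/
theorem translateSum_sub {L : ℕ} {e : ℝ} {f g : ℝ → ℝ} (h : IsSmoothStep e f g)
    (Q : ℕ → ℝ) {η s θ : ℝ} {k : ℕ} (hη : 0 < η) (hk : k < L)
    (h1 : ∀ j : ℕ, j < k → η / 2 ≤ θ - j - s) (h2 : ∀ j : ℕ, k < j → θ - j - s ≤ -(η / 2)) :
    Q 0 + translateSum L (fun j => Q (j + 1) - Q j) f η s θ =
      Q k + (Q (k + 1) - Q k) * f ((θ - k - s) / η) := by
  obtain ⟨d, rfl⟩ : ∃ d, L = k + 1 + d := ⟨L - (k + 1), by omega⟩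
  rw [translateSum, Finset.sum_range_add, Finset.sum_range_succ]
  have e1 : ∑ j ∈ Finset.range k, (Q (j + 1) - Q j) * f ((θ - j - s) / η) = Q k - Q 0 := by
    rw [← Finset.sum_range_sub]
    refine Finset.sum_congr rfl fun j hj => ?_
    rw [h.eq_one, mul_one]
    rw [le_div_iff₀ hη]
    linarith [h1 j (Finset.mem_range.1 hj)]
  have e2 : ∑ j ∈ Finset.range d, (Q (k + 1 + j + 1) - Q (k + 1 + j)) *
      f ((θ - (k + 1 + j : ℕ) - s) / η) = 0 := by
    refine Finset.sum_eq_zero fun j _ => ?_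
    rw [h.eq_zero, mul_zero]
    rw [div_le_iff₀ hη]
    linarith [h2 (k + 1 + j) (by omega)]
  rw [e1, e2]
  ring

theorem translateSum_of_right {L : ℕ} {e : ℝ} {f g : ℝ → ℝ} (h : IsSmoothStep e f g)
    (c : ℕ → ℝ) {η s θ : ℝ} (hη : 0 < η) (hθ : ∀ j < L, η / 2 ≤ θ - j - s) :
    translateSum L c f η s θ = ∑ j ∈ Finset.range L, c j := by
  refine Finset.sum_congr rfl fun j hj => ?_
  rw [h.eq_one, mul_one]
  rw [le_div_iff₀ hη]
  linarith [hθ j (Finset.mem_range.1 hj)]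

theorem translateSum_of_left {L : ℕ} {e : ℝ} {f g : ℝ → ℝ} (h : IsSmoothStep e f g)
    (c : ℕ → ℝ) {η s θ : ℝ} (hη : 0 < η) (hθ : ∀ j : ℕ, θ - j - s ≤ -(η / 2)) :
    translateSum L c f η s θ = 0 := by
  refine Finset.sum_eq_zero fun j _ => ?_
  rw [h.eq_zero, mul_zero]
  rw [div_le_iff₀ hη]
  linarith [hθ j]

/-! ### Wrapping profiles: definition and construction. -/

/-- The data of a wrapping. The strip `|V - κ θ| < u' θ / 2`, `s < θ < t`, of area at least `a` is
wrapped around an annulus of area `A` with circumference one, while a fibre which is a product of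
rectangles of width `π` and height one is moved by the vector `C θ`. -/
structure IsWrappingProfile {m : ℕ} (N : ℕ) (A a : ℝ) (u u' κ : ℝ → ℝ) (C C' : Fin m → ℝ → ℝ)
    (s t : ℝ) : Prop where
  contDiff_u : ContDiff ℝ ∞ u
  contDiff_u' : ContDiff ℝ ∞ u'
  contDiff_κ : ContDiff ℝ ∞ κ
  contDiff_C : ∀ i, ContDiff ℝ ∞ (C i)
  contDiff_C' : ∀ i, ContDiff ℝ ∞ (C' i)
  hasDerivAt_u : ∀ θ, HasDerivAt u (u' θ) θ
  hasDerivAt_C : ∀ i θ, HasDerivAt (C i) (C' i θ) θ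
  u'_pos : ∀ θ, 0 < u' θ
  le : s ≤ t
  u_left : u s ≤ -(a / 2)
  u_right : a / 2 ≤ u t
  abs_C_le : ∀ θ ∈ Ioo s t, ∀ i, |C i θ| ≤ N / 2
  abs_κ_add_le : ∀ θ ∈ Ioo s t, |κ θ| + (u' θ / 2 + Real.pi / 2 * ∑ i, |C' i θ|) ≤ A / 2
  separated : ∀ θ ∈ Ioo s t, ∀ n : ℕ, 1 ≤ n → θ + n ∈ Ioo s t →
    (u' θ / 2 + Real.pi / 2 * ∑ i, |C' i θ|) +
      (u' (θ + n) / 2 + Real.pi / 2 * ∑ i, |C' i (θ + n)|) ≤ |κ θ - κ (θ + n)| ∨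
    ∃ i, 1 ≤ |C i θ - C i (θ + n)|

/-- Away from small neighbourhoods of the integers, a point lies between two of them. -/
theorem exists_near_or_between {η θ : ℝ} {M : ℕ} (hη : 0 < η) (hη1 : η < 1)
    (hθ : θ ∈ Ioo (-(η / 2)) (M + η / 2)) :
    (∃ k : ℕ, k ≤ M ∧ |θ - k| ≤ η / 2) ∨
      ∃ k : ℕ, k < M ∧ η / 2 < θ - k ∧ θ - k < 1 - η / 2 := by
  obtain ⟨h1, h2⟩ := hθ
  rcases lt_or_ge θ 0 with h0 | h0
  · exact Or.inl ⟨0, by omega, by rw [abs_le]; constructor <;> simp <;> linarith⟩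
  have hf := Nat.floor_le h0
  have hl := Nat.lt_floor_add_one θ
  have hk : ⌊θ⌋₊ ≤ M := by
    have : (⌊θ⌋₊ : ℝ) < ((M + 1 : ℕ) : ℝ) := by push_cast; linarith
    have := Nat.cast_lt.1 this
    omega
  by_cases ha : θ - ⌊θ⌋₊ ≤ η / 2
  · exact Or.inl ⟨⌊θ⌋₊, hk, by rw [abs_le]; constructor <;> linarith⟩
  have hk' : ⌊θ⌋₊ < M := by
    refine lt_of_le_of_ne hk fun h => ha ?_
    rw [h]; linarith
  by_cases hb : θ - ⌊θ⌋₊ < 1 - η / 2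
  · exact Or.inr ⟨⌊θ⌋₊, hk', by linarith, hb⟩
  · refine Or.inl ⟨⌊θ⌋₊ + 1, hk', ?_⟩
    rw [abs_le]; push_cast; constructor <;> linarith

theorem one_le_abs_sub_of_ne {j k : ℕ} (h : j ≠ k) : (1 : ℝ) ≤ |(j : ℝ) - k| := by
  have : (1 : ℤ) ≤ |(j : ℤ) - k| := by rw [le_abs]; omega
  exact_mod_cast this

theorem half_le_abs_sub_of_near {η θ : ℝ} {j k : ℕ} (hη1 : η < 1) (h : |θ - k| ≤ η / 2)
    (hj : j ≠ k) : η / 2 ≤ |θ - j - 0| := by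
  have h1 := one_le_abs_sub_of_ne hj
  have h2 := abs_sub_le (j : ℝ) θ k
  rw [abs_sub_comm (j : ℝ) θ] at h2
  rw [sub_zero]; linarith

theorem half_le_abs_sub_half_of_near {η θ : ℝ} {k : ℕ} (h : |θ - k| ≤ η / 2)
    (j : ℕ) : (1 - η) / 2 ≤ |θ - j - 1 / 2| := by
  rw [abs_le] at h
  rcases Nat.lt_or_ge j k with hj | hj
  · have : ((j + 1 : ℕ) : ℝ) ≤ k := Nat.cast_le.2 hj
    push_cast at this
    rw [le_abs]; left; linarith
  · have : (k : ℝ) ≤ j := Nat.cast_le.2 hj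
    rw [le_abs]; right; linarith

theorem half_le_abs_sub_of_between {η θ : ℝ} {k : ℕ} (h1 : η / 2 < θ - k)
    (h2 : θ - k < 1 - η / 2) (j : ℕ) : η / 2 ≤ |θ - j - 0| := by
  rcases Nat.lt_or_ge k j with hj | hj
  · have : ((k + 1 : ℕ) : ℝ) ≤ j := Nat.cast_le.2 hj
    push_cast at this
    rw [le_abs]; right; linarith
  · have : (j : ℝ) ≤ k := Nat.cast_le.2 hj
    rw [le_abs]; left; linarith

theorem half_le_abs_sub_half_of_between {η θ : ℝ} {j k : ℕ} (hη : 0 < η) (h1 : η / 2 < θ - k)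
    (h2 : θ - k < 1 - η / 2) (hjk : j ≠ k) : (1 - η) / 2 ≤ |θ - j - 1 / 2| := by
  rcases Nat.lt_or_ge j k with hj | hj
  · have : ((j + 1 : ℕ) : ℝ) ≤ k := Nat.cast_le.2 hj
    push_cast at this
    rw [le_abs]; left; linarith
  · have : ((k + 1 : ℕ) : ℝ) ≤ j := Nat.cast_le.2 (by omega)
    push_cast at this
    rw [le_abs]; right; linarith

/-- B is a usable height slightly below A, and e is the permitted slope of the steps. The width δ
keeps the strip open everywhere; the oscillation γ cos(πθ) of its centre line separates the extra
width on neighbouring turns near integers. Both are paid for by A - eB. -/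
theorem exists_wrapping_parameters {M : ℕ} {A a : ℝ} (hM : 1 ≤ M) (hA : 2 * Real.pi < A)
    (ha : a - 2 * Real.pi < M * (A - 2 * Real.pi)) :
    ∃ B e γ δ : ℝ, 2 * Real.pi < B ∧ a ≤ M * (B - 2 * Real.pi) + 2 * Real.pi ∧ 1 < e ∧
      e * B < A ∧ 0 < γ ∧ 0 < δ ∧ γ + δ / 2 + B * e / 2 ≤ A / 2 ∧
      δ / 2 ≤ γ * Real.cos (Real.pi * (2 * Real.pi / B / 2)) := by
  have hpi := Real.pi_pos
  have hM0 : (0 : ℝ) < M := by exact_mod_cast hM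
  have hm : max (2 * Real.pi) ((a - 2 * Real.pi) / M + 2 * Real.pi) < A := by
    refine max_lt hA ?_
    rw [← lt_sub_iff_add_lt, div_lt_iff₀ hM0]
    linarith
  obtain ⟨B, hB1, hB2⟩ := exists_between hm
  have hB0 : 2 * Real.pi < B := (le_max_left _ _).trans_lt hB1
  have hBpos : 0 < B := by linarith
  have hB3 := (le_max_right _ _).trans_lt hB1
  rw [← lt_sub_iff_add_lt, div_lt_iff₀ hM0] at hB3
  obtain ⟨e, he1, he2⟩ := exists_between ((one_lt_div hBpos).2 hB2)
  rw [lt_div_iff₀ hBpos] at he2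
  have hcos : 0 < Real.cos (Real.pi * (2 * Real.pi / B / 2)) := by
    apply Real.cos_pos_of_mem_Ioo
    have h1 : 2 * Real.pi / B < 1 := by rw [div_lt_one hBpos]; exact hB0
    have h2 : 0 < 2 * Real.pi / B := by positivity
    constructor <;> nlinarith
  have hγ : 0 < (A - e * B) / 4 := by linarith
  have hle := mul_le_of_le_one_right hγ.le (Real.cos_le_one (Real.pi * (2 * Real.pi / B / 2)))
  have hpos := mul_pos hγ hcos
  exact ⟨B, e, (A - e * B) / 4, _, hB0, by linarith, he1, he2, hγ, hpos, by linarith, by linarith⟩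

/-- The stationary ends each contribute one; this is the source of the additional area 2π. -/
theorem two_le_sum_one_sub {M : ℕ} (hM : 1 ≤ M) {Δ : ℕ → ℝ} (h1 : ∀ j, Δ j ≤ 1) (h0 : Δ 0 = 0)
    (hlast : Δ M = 0) : 2 ≤ ∑ j ∈ Finset.range (M + 1), (1 - Δ j) := by
  obtain ⟨M, rfl⟩ : ∃ M', M = M' + 1 := ⟨M - 1, by omega⟩
  rw [Finset.sum_range_succ, Finset.sum_range_succ', h0, hlast]
  have : 0 ≤ ∑ j ∈ Finset.range M, (1 - Δ (j + 1)) :=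
    Finset.sum_nonneg fun j _ => by linarith [h1 (j + 1)]
  linarith

/-- Only increments of `u` carry meaning, so the strip may be recentred. -/
theorem IsWrappingProfile.sub_const {m N : ℕ} {A a b c : ℝ} {u u' κ : ℝ → ℝ}
    {C C' : Fin m → ℝ → ℝ} {s t : ℝ} (h : IsWrappingProfile N A a u u' κ C C' s t)
    (hl : u s - c ≤ -(b / 2)) (hr : b / 2 ≤ u t - c) :
    IsWrappingProfile N A b (fun θ => u θ - c) u' κ C C' s t :=
  { h with
    contDiff_u := h.contDiff_u.sub contDiff_const
    hasDerivAt_u := fun θ => (h.hasDerivAt_u θ).sub_const c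
    u_left := hl
    u_right := hr }

set_option maxHeartbeats 1000000 in
-- Near each integer k the fibre moves from `P k` to `P (k + 1)`, during an interval of length η; in
-- between it rests at `P (k + 1)`. There are M rests and M + 1 intervals near integers, the outer
-- two without motion.
theorem exists_isWrappingProfile (m N : ℕ) {A a : ℝ} (hA : 2 * Real.pi < A)
    (ha : a - 2 * Real.pi < (N + 1) ^ m * (A - 2 * Real.pi)) :
    ∃ (u u' κ : ℝ → ℝ) (C C' : Fin m → ℝ → ℝ) (s t : ℝ),
      IsWrappingProfile N A a u u' κ C C' s t := by
  obtain ⟨P, hPmem, hPstep, hP0, hPlast, hPne⟩ := exists_lattice_path_extended N m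
  have hM : 1 ≤ (N + 1) ^ m := Nat.one_le_pow _ _ (by omega)
  have ha' : a - 2 * Real.pi < ((N + 1) ^ m : ℕ) * (A - 2 * Real.pi) := by
    push_cast; exact ha
  generalize (N + 1) ^ m = M at *
  have hpi := Real.pi_pos
  obtain ⟨B, e, γ, δ, hB, haB, he, heB, hγ, hδ, hsum, hcos⟩ := exists_wrapping_parameters hM hA ha'
  obtain ⟨f, g, hf⟩ := exists_isSmoothStep he
  have hB0 : 0 < B := by linarith
  -- With this duration a unit move of a fibre of width π spreads V by B/2 times the slope of the
  -- step: half of the usable height.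
  obtain ⟨η, hηdef⟩ : ∃ η, η = 2 * Real.pi / B := ⟨_, rfl⟩
  rw [← hηdef] at hcos
  have hη : 0 < η := by rw [hηdef]; positivity
  have hη1 : η < 1 := by rw [hηdef, div_lt_one hB0]; exact hB
  have hηB : η * B = 2 * Real.pi := by rw [hηdef]; field_simp
  have hηi : Real.pi / 2 * η⁻¹ = B / 4 := by rw [hηdef]; field_simp; ring
  obtain ⟨Δ, hΔ⟩ : ∃ Δ : ℕ → ℝ, ∀ j, Δ j = ∑ i, |(P (j + 1) i - P j i : ℝ)| := ⟨_, fun _ => rfl⟩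
  have hΔ1 : ∀ j, Δ j ≤ 1 := fun j => by rw [hΔ]; exact_mod_cast hPstep j
  have hΔ0 : Δ 0 = 0 := by simp [hΔ, hP0]
  have hΔM : Δ M = 0 := by simp [hΔ, hPlast]
  -- Apart from δ, each rest contributes area (1 - η)B = B - 2π, and the interval around the integer
  -- j contributes π(1 - `Δ j`). The total is at least M(B - 2π) + 2π.
  let u : ℝ → ℝ := fun θ => δ * θ + (1 - η) * B * translateSum M (fun _ => 1) f (1 - η) (1 / 2) θ +
    η * (B / 2) * translateSum (M + 1) (fun j => 1 - Δ j) f η 0 θ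
  let u' : ℝ → ℝ := fun θ => δ + B * translateSum M (fun _ => 1) g (1 - η) (1 / 2) θ +
    B / 2 * translateSum (M + 1) (fun j => 1 - Δ j) g η 0 θ
  -- Both terms change sign from one integer to the next, placing consecutive moves in opposite
  -- halves of the annulus.
  let κ : ℝ → ℝ := fun θ => γ * Real.cos (Real.pi * θ) +
    B / 4 * translateSum (M + 1) (fun j => (-1) ^ j) g η 0 θ
  let C : Fin m → ℝ → ℝ := fun i θ =>
    P 0 i + translateSum (M + 1) (fun j => (P (j + 1) i - P j i : ℝ)) f η 0 θ - N / 2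
  let C' : Fin m → ℝ → ℝ := fun i θ =>
    η⁻¹ * translateSum (M + 1) (fun j => (P (j + 1) i - P j i : ℝ)) g η 0 θ
  -- The strip's own width and the spread caused by the motion are complementary: `1 - Δ k` and `Δ
  -- k` add up to one, so the half-extent does not depend on `Δ`.
  have near : ∀ (θ : ℝ) (k : ℕ), k ≤ M → |θ - k| ≤ η / 2 →
      u' θ / 2 + Real.pi / 2 * ∑ i, |C' i θ| = δ / 2 + B / 4 * g ((θ - k) / η) ∧
      κ θ = (-1) ^ k * (γ * Real.cos (Real.pi * (θ - k)) + B / 4 * g ((θ - k) / η)) ∧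
      ∀ i, C i θ = P k i + (P (k + 1) i - P k i : ℝ) * f ((θ - k) / η) - N / 2 := by
    intro θ k hk hθ
    have hs : ∀ c : ℕ → ℝ, translateSum (M + 1) c g η 0 θ = c k * g ((θ - k) / η) := fun c => by
      rw [translateSum_eq_single hf c hη (Nat.lt_succ_of_le hk) fun j hj =>
        half_le_abs_sub_of_near hη1 hθ hj, sub_zero]
    have hz : translateSum M (fun _ => 1) g (1 - η) (1 / 2) θ = 0 :=
      translateSum_eq_zero hf _ (by linarith) (half_le_abs_sub_half_of_near hθ)
    refine ⟨?_, ?_, fun i => ?_⟩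
    · have h1 : ∑ i, |C' i θ| = η⁻¹ * g ((θ - k) / η) * Δ k := by
        rw [hΔ, Finset.mul_sum]
        refine Finset.sum_congr rfl fun i _ => ?_
        simp only [C', hs, abs_mul, abs_of_nonneg (hf.slope_nonneg _), abs_of_pos (inv_pos.2 hη)]
        ring
      simp only [u', hs, hz, h1]
      linear_combination g ((θ - k) / η) * Δ k * hηi
    · have h2 : Real.cos (Real.pi * θ) = (-1) ^ k * Real.cos (Real.pi * (θ - k)) := by
        rw [← Real.cos_add_nat_mul_pi]; ring_nf
      simp only [κ, hs, h2]; ring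
    · have h3 := translateSum_sub hf (fun j => (P j i : ℝ)) hη (Nat.lt_succ_of_le hk) (θ := θ)
        (s := 0) (fun j hj => ?_) (fun j hj => ?_)
      · rw [sub_zero] at h3
        simp only [C, h3]
      · have : ((j + 1 : ℕ) : ℝ) ≤ k := Nat.cast_le.2 hj
        push_cast at this
        linarith [(abs_le.1 hθ).1]
      · have : ((k + 1 : ℕ) : ℝ) ≤ j := Nat.cast_le.2 hj
        push_cast at this
        linarith [(abs_le.1 hθ).2]
  have between : ∀ (θ : ℝ) (k : ℕ), k < M → η / 2 < θ - k → θ - k < 1 - η / 2 →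
      u' θ / 2 + Real.pi / 2 * ∑ i, |C' i θ| =
        δ / 2 + B / 2 * g ((θ - k - 1 / 2) / (1 - η)) ∧
      κ θ = γ * Real.cos (Real.pi * θ) ∧ ∀ i, C i θ = P (k + 1) i - N / 2 := by
    intro θ k hk h1 h2
    have hz : ∀ c : ℕ → ℝ, translateSum (M + 1) c g η 0 θ = 0 := fun c =>
      translateSum_eq_zero hf _ hη (half_le_abs_sub_of_between h1 h2)
    have hs : translateSum M (fun _ => 1) g (1 - η) (1 / 2) θ =
        1 * g ((θ - k - 1 / 2) / (1 - η)) :=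
      translateSum_eq_single hf _ (by linarith) hk
        fun j hj => half_le_abs_sub_half_of_between hη h1 h2 hj
    refine ⟨?_, ?_, fun i => ?_⟩
    · simp only [u', C', hs, hz]; simp; ring
    · simp only [κ, hz]; ring
    · have h3 := translateSum_sub hf (fun j => (P j i : ℝ)) hη (hk.trans (Nat.lt_succ_self _))
        (θ := θ) (s := 0) (fun j hj => ?_) (fun j hj => ?_)
      · rw [hf.eq_one _ (by rw [le_div_iff₀ hη]; linarith)] at h3
        simp only [C, h3]; ring
      · have : ((j + 1 : ℕ) : ℝ) ≤ k := Nat.cast_le.2 hj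
        push_cast at this
        linarith
      · have : ((k + 1 : ℕ) : ℝ) ≤ j := Nat.cast_le.2 hj
        push_cast at this
        linarith
  have hu_left : u (-(η / 2)) = δ * -(η / 2) := by
    have h1 := translateSum_of_left hf (L := M) (fun _ => 1) (η := 1 - η) (s := 1 / 2)
      (θ := -(η / 2)) (by linarith) fun j => by
        have : (0 : ℝ) ≤ j := Nat.cast_nonneg j
        linarith
    have h2 := translateSum_of_left hf (L := M + 1) (fun j => 1 - Δ j) (s := 0)
      (θ := -(η / 2)) hη fun j => by
        have : (0 : ℝ) ≤ j := Nat.cast_nonneg j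
        linarith
    simp only [u, h1, h2]; ring
  have hu_right : a + δ * (M + η / 2) ≤ u (M + η / 2) := by
    have h1 := translateSum_of_right hf (L := M) (fun _ => 1) (η := 1 - η) (s := 1 / 2)
      (θ := M + η / 2) (by linarith) fun j hj => by
        have : ((j + 1 : ℕ) : ℝ) ≤ M := Nat.cast_le.2 hj
        push_cast at this
        linarith
    have h2 := translateSum_of_right hf (L := M + 1) (fun j => 1 - Δ j) (s := 0)
      (θ := M + η / 2) hη fun j hj => by
        have : (j : ℝ) ≤ M := Nat.cast_le.2 (Nat.lt_succ_iff.1 hj)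
        linarith
    have h3 := two_le_sum_one_sub hM hΔ1 hΔ0 hΔM
    simp only [u, h1, h2, Finset.sum_const, Finset.card_range, nsmul_eq_mul, mul_one]
    nlinarith
  have hgl := fun t => mul_le_mul_of_nonneg_left (hf.slope_le t) hB0.le
  have hg0 := fun t => mul_nonneg hB0.le (hf.slope_nonneg t)
  have hprofile : IsWrappingProfile N A (-(2 * u (-(η / 2))) ⊓ (2 * u (M + η / 2))) u u' κ C C'
      (-(η / 2)) (M + η / 2) := by
    refine ⟨?_, ?_, ?_, fun i => ?_, fun i => ?_, ?_, ?_, ?_, ?_, ?_, ?_, ?_, ?_, ?_⟩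
    · exact ((contDiff_const.mul contDiff_id).add (contDiff_const.mul
        (contDiff_translateSum _ _ hf.contDiff _ _))).add (contDiff_const.mul
        (contDiff_translateSum _ _ hf.contDiff _ _))
    · exact (contDiff_const.add (contDiff_const.mul
        (contDiff_translateSum _ _ hf.contDiff_slope _ _))).add (contDiff_const.mul
        (contDiff_translateSum _ _ hf.contDiff_slope _ _))
    · exact (contDiff_const.mul (Real.contDiff_cos.comp (contDiff_const.mul contDiff_id))).add
        (contDiff_const.mul (contDiff_translateSum _ _ hf.contDiff_slope _ _))
    · exact (contDiff_const.add (contDiff_translateSum _ _ hf.contDiff _ _)).sub contDiff_const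
    · exact contDiff_const.mul (contDiff_translateSum _ _ hf.contDiff_slope _ _)
    · intro θ
      have h1 := (hasDerivAt_translateSum M (fun _ => 1) hf.hasDerivAt (1 - η) (1 / 2) θ).const_mul
        ((1 - η) * B)
      have h2 := (hasDerivAt_translateSum (M + 1) (fun j => 1 - Δ j) hf.hasDerivAt η 0 θ).const_mul
        (η * (B / 2))
      have h3 := (((hasDerivAt_id θ).const_mul δ).add h1).add h2
      convert! h3 using 1
      have : 1 - η ≠ 0 := by linarith
      simp only [u']
      field_simp
    · intro i θ
      exact ((hasDerivAt_translateSum (M + 1) _ hf.hasDerivAt η 0 θ).const_add _).sub_const _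
    · intro θ
      have h1 : 0 ≤ translateSum M (fun _ => 1) g (1 - η) (1 / 2) θ :=
        Finset.sum_nonneg fun j _ => mul_nonneg zero_le_one (hf.slope_nonneg _)
      have h2 : 0 ≤ translateSum (M + 1) (fun j => 1 - Δ j) g η 0 θ :=
        Finset.sum_nonneg fun j _ => mul_nonneg (by linarith [hΔ1 j]) (hf.slope_nonneg _)
      simp only [u']
      positivity
    · have : (0 : ℝ) ≤ M := Nat.cast_nonneg M
      linarith
    · have := min_le_left (-(2 * u (-(η / 2)))) (2 * u (M + η / 2))
      linarith
    · have := min_le_right (-(2 * u (-(η / 2)))) (2 * u (M + η / 2))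
      linarith
    · intro θ hθ i
      have hcast : ∀ k, (0 : ℝ) ≤ P k i ∧ (P k i : ℝ) ≤ N := fun k =>
        ⟨by exact_mod_cast (hPmem k i).1, by exact_mod_cast (hPmem k i).2⟩
      rcases exists_near_or_between hη hη1 hθ with ⟨k, hk, h⟩ | ⟨k, hk, h1, h2⟩
      · rw [(near θ k hk h).2.2 i, abs_le]
        obtain ⟨h0, h1⟩ := hf.mem_Icc ((θ - k) / η)
        have hk0 := hcast k
        have hk1 := hcast (k + 1)
        constructor <;> nlinarith
      · rw [(between θ k hk h1 h2).2.2 i, abs_le]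
        have := hcast (k + 1)
        constructor <;> linarith
    · intro θ hθ
      have hγcos : ∀ x, |γ * Real.cos x| ≤ γ := fun x => by
        rw [abs_mul, abs_of_pos hγ]
        exact mul_le_of_le_one_right hγ.le (Real.abs_cos_le_one x)
      rcases exists_near_or_between hη hη1 hθ with ⟨k, hk, h⟩ | ⟨k, hk, h1, h2⟩
      · obtain ⟨e1, e2, -⟩ := near θ k hk h
        rw [e1, e2, abs_mul, abs_pow, abs_neg, abs_one, one_pow, one_mul]
        have h3 := abs_add_le (γ * Real.cos (Real.pi * (θ - k))) (B / 4 * g ((θ - k) / η))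
        have h4 := hgl ((θ - k) / η)
        have h5 := hg0 ((θ - k) / η)
        rw [abs_of_nonneg (a := B / 4 * g ((θ - k) / η)) (by linarith)] at h3
        linarith [hγcos (Real.pi * (θ - k))]
      · obtain ⟨e1, e2, -⟩ := between θ k hk h1 h2
        rw [e1, e2]
        linarith [hγcos (Real.pi * θ), hgl ((θ - k - 1 / 2) / (1 - η))]
    · intro θ hθ n hn hθn
      rcases exists_near_or_between hη hη1 hθ with ⟨k, hk, h⟩ | ⟨k, hk, h1, h2⟩
      · have hc : θ + n - ((k + n : ℕ) : ℝ) = θ - k := by push_cast; ring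
        have hkn : k + n ≤ M := by
          have h1 := (abs_le.1 h).1
          have h2 := hθn.2
          have : ((k + n : ℕ) : ℝ) < ((M + 1 : ℕ) : ℝ) := by push_cast; linarith
          have := Nat.cast_lt.1 this
          omega
        obtain ⟨e1, e2, e3⟩ := near θ k hk h
        obtain ⟨e1', e2', e3'⟩ := near (θ + n) (k + n) hkn (by rwa [hc])
        rw [hc] at e1' e2'
        -- An even shift is at least two, so the edges are disjoint and the fibres separate. An odd
        -- shift reverses the sign of `κ`, and the V-intervals separate.
        rcases Nat.even_or_odd n with hev | hodd
        · right
          have h2n : 2 ≤ n := by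
            obtain ⟨l, rfl⟩ := hev; omega
          have hne := hPne k (by omega)
          obtain ⟨i, hi⟩ := exists_one_le_abs_sub (hPstep k) (hPstep (k + n))
            (hne _ (by omega) _ (by omega)) (hne _ (by omega) _ (by omega))
            (hne _ le_rfl _ (by omega)) (hne _ le_rfl _ (by omega))
            (hf.mem_Icc ((θ - k) / η)) (hf.mem_Icc ((θ - k) / η))
          refine ⟨i, ?_⟩
          rw [e3 i, e3' i, hc]
          convert hi using 2
          ring
        · left
          rw [e1, e1', e2, e2', pow_add, hodd.neg_one_pow]
          have h3 : Real.cos (Real.pi * (η / 2)) ≤ Real.cos (Real.pi * (θ - k)) := by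
            rw [← Real.cos_abs (Real.pi * (θ - k)), abs_mul, abs_of_pos hpi]
            apply Real.cos_le_cos_of_nonneg_of_le_pi (by positivity) (by nlinarith)
            exact mul_le_mul_of_nonneg_left h hpi.le
          have h4 := mul_le_mul_of_nonneg_left h3 hγ.le
          rw [show ∀ x : ℝ, (-1) ^ k * x - (-1) ^ k * -1 * x = (-1) ^ k * (2 * x) by
            intro x; ring, abs_mul, abs_pow, abs_neg, abs_one, one_pow, one_mul]
          refine le_trans ?_ (le_abs_self _)
          linarith
      · right
        have hkn : k + n < M := by
          have h3 := hθn.2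
          have : ((k + n : ℕ) : ℝ) < M := by push_cast; linarith
          exact Nat.cast_lt.1 this
        obtain ⟨-, -, e3⟩ := between θ k hk h1 h2
        obtain ⟨-, -, e3'⟩ := between (θ + n) (k + n) hkn (by push_cast; linarith)
          (by push_cast; linarith)
        -- At rest, distinct turns sit at distinct lattice points.
        obtain ⟨i, hi⟩ := Function.ne_iff.1
          (hPne k (by omega) (k + 1) le_rfl (k + n + 1) (by omega))
        refine ⟨i, ?_⟩
        rw [e3 i, e3' i, sub_sub_sub_cancel_right]
        have : 1 ≤ |P (k + 1) i - P (k + n + 1) i| := by rw [le_abs]; omega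
        exact_mod_cast this
  have hM0 : (0 : ℝ) ≤ M := Nat.cast_nonneg M
  have hδη : 0 < δ * η := mul_pos hδ hη
  have hδM : 0 ≤ δ * M := mul_nonneg hδ.le hM0
  exact ⟨_, u', κ, C, C', _, _, hprofile.sub_const
    (c := (u (-(η / 2)) + u (M + η / 2)) / 2) (by linarith) (by linarith)⟩

/-! ### The symplectic shear. -/

/-- The generating data of the shear which moves the fibre over `θ` by `C θ`. -/
noncomputable def shearTerm {m : ℕ} (C C' : Fin m → ℝ → ℝ) (κ : ℝ → ℝ) (i : Fin (m + 1)) :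
    (Fin (m + 1) → ℂ) → ℝ :=
  Fin.lastCases (motive := fun _ => (Fin (m + 1) → ℂ) → ℝ)
    (fun z => ∑ j, C' j (z (Fin.last m)).re * (z (Fin.castSucc j)).re + κ (z (Fin.last m)).re)
    (fun j z => C j (z (Fin.last m)).re) i

/-- The lift `(x, y; θ, V) ↦ (x, y + C θ; θ, V + C' θ · x + κ θ)`. -/
noncomputable def shear {m : ℕ} (C C' : Fin m → ℝ → ℝ) (κ : ℝ → ℝ) (z : Fin (m + 1) → ℂ) :
    Fin (m + 1) → ℂ := fun i => z i + shearTerm C C' κ i z • Complex.I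

section shear

variable {m : ℕ} {C C' : Fin m → ℝ → ℝ} {κ : ℝ → ℝ}

theorem shear_re (z : Fin (m + 1) → ℂ) (i : Fin (m + 1)) : (shear C C' κ z i).re = (z i).re := by
  simp [shear]

theorem shear_im (z : Fin (m + 1) → ℂ) (i : Fin (m + 1)) :
    (shear C C' κ z i).im = (z i).im + shearTerm C C' κ i z := by
  simp [shear]

theorem shear_castSucc_im (z : Fin (m + 1) → ℂ) (i : Fin m) :
    (shear C C' κ z i.castSucc).im = (z i.castSucc).im + C i (z (Fin.last m)).re := by
  simp [shear_im, shearTerm]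

theorem shear_last_im (z : Fin (m + 1) → ℂ) :
    (shear C C' κ z (Fin.last m)).im = (z (Fin.last m)).im +
      (∑ j, C' j (z (Fin.last m)).re * (z (Fin.castSucc j)).re + κ (z (Fin.last m)).re) := by
  simp [shear_im, shearTerm]

theorem shear_injective : Function.Injective (shear C C' κ) := by
  intro z w h
  have hre : ∀ i, (z i).re = (w i).re := fun i => by
    rw [← shear_re (C := C) (C' := C') (κ := κ) z, h, shear_re]
  funext i
  refine Complex.ext (hre i) ?_
  have him := congrArg Complex.im (congrFun h i)
  rw [shear_im, shear_im] at him
  have : shearTerm C C' κ i z = shearTerm C C' κ i w := by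
    refine Fin.lastCases ?_ (fun j => ?_) i <;> simp [shearTerm, hre]
  linarith

theorem contDiff_shearTerm (hC : ∀ i, ContDiff ℝ ∞ (C i)) (hC' : ∀ i, ContDiff ℝ ∞ (C' i))
    (hκ : ContDiff ℝ ∞ κ) (i : Fin (m + 1)) : ContDiff ℝ ∞ (shearTerm C C' κ i) := by
  have hre : ∀ i, ContDiff ℝ ∞ fun z : Fin (m + 1) → ℂ => (z i).re := fun i =>
    Complex.reCLM.contDiff.comp (contDiff_apply ℝ ℂ i)
  refine Fin.lastCases ?_ (fun j => ?_) i
  · simp only [shearTerm, Fin.lastCases_last]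
    exact (ContDiff.sum fun j _ => ((hC' j).comp (hre _)).mul (hre _)).add (hκ.comp (hre _))
  · simp only [shearTerm, Fin.lastCases_castSucc]
    exact (hC j).comp (hre _)

/-- The shear adds to the imaginary parts the gradient of a function of the real parts, namely
x·C(θ) plus a primitive of κ. It is symplectic because the Hessian is symmetric. -/
theorem isSymplecticOn_shear (hC : ∀ i, ContDiff ℝ ∞ (C i)) (hC' : ∀ i, ContDiff ℝ ∞ (C' i))
    (hκ : ContDiff ℝ ∞ κ) (hd : ∀ i θ, HasDerivAt (C i) (C' i θ) θ) :
    IsSymplecticOn (shear C C' κ) univ where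
  contDiffOn := (contDiff_pi.2 fun i => (contDiff_apply ℝ ℂ i).add
    ((contDiff_shearTerm hC hC' hκ i).smul contDiff_const)).contDiffOn
  pullback_eq z _ u v := by
    have hre : ∀ i, HasFDerivAt (fun z : Fin (m + 1) → ℂ => (z i).re)
        (Complex.reCLM.comp (ContinuousLinearMap.proj i)) z := fun i =>
      Complex.reCLM.hasFDerivAt.comp z (ContinuousLinearMap.proj (R := ℝ)
        (φ := fun _ : Fin (m + 1) => ℂ) i).hasFDerivAt
    have hterm : ∀ i, HasFDerivAt (shearTerm C C' κ i) (fderiv ℝ (shearTerm C C' κ i) z) z :=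
      fun i => ((contDiff_shearTerm hC hC' hκ i).differentiable (by simp) z).hasFDerivAt
    have hfib : ∀ i w, fderiv ℝ (shearTerm C C' κ (Fin.castSucc i)) z w =
        C' i (z (Fin.last m)).re * (w (Fin.last m)).re := by
      intro i w
      have h := (hd i (z (Fin.last m)).re).comp_hasFDerivAt z (hre (Fin.last m))
      have e : shearTerm C C' κ (Fin.castSucc i) =
          C i ∘ fun z : Fin (m + 1) → ℂ => (z (Fin.last m)).re := by
        funext z; simp [shearTerm]
      rw [e, h.fderiv]
      simp
    -- The coefficient `S` is the second derivative in θ alone; it cancels in the antisymmetric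
    -- form, so its value is irrelevant.
    have hbase : ∃ S : ℝ, ∀ w, fderiv ℝ (shearTerm C C' κ (Fin.last m)) z w =
        ∑ j, C' j (z (Fin.last m)).re * (w (Fin.castSucc j)).re + S * (w (Fin.last m)).re := by
      have h1 := fun j => (((hC' j).differentiable (by simp)
        (z (Fin.last m)).re).hasDerivAt.comp_hasFDerivAt z (hre (Fin.last m))).mul
          (hre (Fin.castSucc j))
      have h := (HasFDerivAt.fun_sum fun j (_ : j ∈ Finset.univ) => h1 j).add
        ((hκ.differentiable (by simp) (z (Fin.last m)).re).hasDerivAt.comp_hasFDerivAt z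
          (hre (Fin.last m)))
      have e : shearTerm C C' κ (Fin.last m) = fun z : Fin (m + 1) → ℂ =>
          ∑ j, C' j (z (Fin.last m)).re * (z (Fin.castSucc j)).re + κ (z (Fin.last m)).re := by
        funext z; simp [shearTerm]
      refine ⟨∑ j, (z (Fin.castSucc j)).re * deriv (C' j) (z (Fin.last m)).re +
        deriv κ (z (Fin.last m)).re, fun w => ?_⟩
      rw [e]
      refine (congrArg (fun L : (Fin (m + 1) → ℂ) →L[ℝ] ℝ => L w) h.fderiv).trans ?_
      simp [Finset.sum_add_distrib, add_mul, Finset.sum_mul, mul_assoc, add_assoc]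
    obtain ⟨S, hS⟩ := hbase
    have hD : HasFDerivAt (shear C C' κ) (ContinuousLinearMap.pi fun i =>
        ContinuousLinearMap.proj i +
          (fderiv ℝ (shearTerm C C' κ i) z).smulRight Complex.I) z := by
      rw [hasFDerivAt_pi]
      exact fun i => (ContinuousLinearMap.proj (R := ℝ)
        (φ := fun _ : Fin (m + 1) => ℂ) i).hasFDerivAt.add ((hterm i).smul_const Complex.I)
    rw [hD.fderiv]
    simp only [stdSymplecticForm, Fin.sum_univ_castSucc]
    simp [hfib, hS]
    simp only [mul_add, add_mul, Finset.sum_add_distrib, Finset.mul_sum,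
      Finset.sum_mul]
    have e1 : ∑ i, (u (Fin.castSucc i)).re *
        (C' i (z (Fin.last m)).re * (v (Fin.last m)).re) =
        ∑ i, C' i (z (Fin.last m)).re * (u (Fin.castSucc i)).re * (v (Fin.last m)).re :=
      Finset.sum_congr rfl fun i _ => by ring
    have e2 : ∑ i, (u (Fin.last m)).re *
        (C' i (z (Fin.last m)).re * (v (Fin.castSucc i)).re) =
        ∑ i, C' i (z (Fin.last m)).re * (u (Fin.last m)).re * (v (Fin.castSucc i)).re :=
      Finset.sum_congr rfl fun i _ => by ring
    rw [e1, e2]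
    ring

end shear

/-! ### Discs, rectangles and strips. -/

theorem injOn_stretch {F F' : ℝ → ℝ} {I : Set ℝ} (hF : InjOn F I) (h0 : ∀ x ∈ I, F' x ≠ 0) :
    InjOn (stretch F F') {z | z.re ∈ I} := by
  intro z hz w hw h
  have hre : z.re = w.re := hF hz hw (congrArg Complex.re h)
  have him : z.im / F' z.re = w.im / F' w.re := congrArg Complex.im h
  rw [hre] at him
  exact Complex.ext hre ((div_left_inj' (h0 _ hw)).1 him)

theorem IsAreaPreservingOn.mono {φ : ℂ → ℂ} {U V : Set ℂ} (h : IsAreaPreservingOn φ U)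
    (hV : V ⊆ U) : IsAreaPreservingOn φ V :=
  ⟨h.contDiffOn.mono hV, fun z hz => h.pullback_eq z (hV hz)⟩

theorem isOpen_setOf_re_mem {I : Set ℝ} (hI : IsOpen I) : IsOpen {z : ℂ | z.re ∈ I} :=
  hI.preimage Complex.continuous_re

theorem isOpen_openDisc (a : ℝ) : IsOpen (openDisc a) :=
  isOpen_lt (by fun_prop) continuous_const

theorem mem_openDisc_iff {r : ℝ} {z : ℂ} :
    z ∈ openDisc (Real.pi * r ^ 2) ↔ z.re ^ 2 + z.im ^ 2 < r ^ 2 := by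
  simp only [openDisc, mem_ofPred_eq]
  rw [mul_lt_mul_iff_right₀ Real.pi_pos, ← Complex.normSq_eq_norm_sq, Complex.normSq_apply, ← sq,
    ← sq]

theorem re_mem_of_mem_openDisc {r : ℝ} (hr : 0 < r) {z : ℂ} (hz : z ∈ openDisc (Real.pi * r ^ 2)) :
    z.re ∈ Ioo (-r) r := by
  rw [mem_openDisc_iff] at hz
  exact abs_lt.1 (abs_lt_of_sq_lt_sq (by nlinarith [sq_nonneg z.im]) hr.le)

/-- The area preserving diffeomorphism from an open disc onto an open rectangle of height one. -/
theorem exists_disc_to_rectangle {a : ℝ} (ha : 0 < a) : ∃ φ : ℂ → ℂ,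
    IsAreaPreservingOn φ (openDisc a) ∧ InjOn φ (openDisc a) ∧
    ∀ z ∈ openDisc a, |(φ z).re| < a / 2 ∧ |(φ z).im| < 1 / 2 := by
  obtain ⟨r, hr, rfl⟩ : ∃ r, 0 < r ∧ a = Real.pi * r ^ 2 :=
    ⟨√(a / Real.pi), Real.sqrt_pos.2 (div_pos ha Real.pi_pos), by
      rw [Real.sq_sqrt (div_pos ha Real.pi_pos).le]; field_simp⟩
  have hsub : openDisc (Real.pi * r ^ 2) ⊆ {z | z.re ∈ Ioo (-r) r} :=
    fun z hz => re_mem_of_mem_openDisc hr hz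
  refine ⟨stretch (discArea r) (discWidth r), ?_, ?_, fun z hz => ⟨?_, ?_⟩⟩
  · exact (isAreaPreservingOn_stretch isOpen_Ioo (contDiffOn_discArea hr) (contDiffOn_discWidth r)
      (fun x hx => hasDerivAt_discArea hr hx) fun x hx => (discWidth_pos hx).ne').mono hsub
  · exact (injOn_stretch ((strictMonoOn_discArea hr).injOn.mono Ioo_subset_Icc_self)
      fun x hx => (discWidth_pos hx).ne').mono hsub
  · exact abs_discArea_lt hr (hsub hz)
  · have hre : z.re ∈ Ioo (-r) r := hsub hz
    rw [mem_openDisc_iff] at hz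
    have : |z.im| < √(r ^ 2 - z.re ^ 2) := by
      rw [Real.lt_sqrt (abs_nonneg _), sq_abs]; linarith
    have hw := discWidth_pos hre
    simp only [stretch]
    rw [abs_div, abs_of_pos hw, div_lt_iff₀ hw, discWidth]
    linarith

/-- The area preserving diffeomorphism from an open rectangle of width `b` onto an open disc. -/
theorem exists_rectangle_to_disc {A b : ℝ} (hA : 0 < A) (hb : 0 < b) : ∃ φ : ℂ → ℂ,
    IsAreaPreservingOn φ {z | z.re ∈ Ioo (-(b / 2)) (b / 2)} ∧
    InjOn φ {z | z.re ∈ Ioo (-(b / 2)) (b / 2)} ∧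
    ∀ z ∈ {z : ℂ | z.re ∈ Ioo (-(b / 2)) (b / 2)}, |z.im| * b < A / 2 → φ z ∈ openDisc A := by
  obtain ⟨r, hr, rfl⟩ : ∃ r, 0 < r ∧ A = Real.pi * r ^ 2 :=
    ⟨√(A / Real.pi), Real.sqrt_pos.2 (div_pos hA Real.pi_pos), by
      rw [Real.sq_sqrt (div_pos hA Real.pi_pos).le]; field_simp⟩
  obtain ⟨G, hG, hFG⟩ := exists_inverse_discArea hr
  set A := Real.pi * r ^ 2 with hAdef
  obtain ⟨hGc, hGd⟩ := contDiffOn_of_rightInverse isOpen_Ioo (contDiffOn_discArea hr)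
    (fun x hx => hasDerivAt_discArea hr hx) (fun x hx => (discWidth_pos hx).ne')
    ((strictMonoOn_discArea hr).injOn.mono Ioo_subset_Icc_self) hG hFG isOpen_Ioo
  have hmap : MapsTo (fun x => x * (A / b)) (Ioo (-(b / 2)) (b / 2)) (Ioo (-(A / 2)) (A / 2)) := by
    intro x hx
    have hc : 0 < A / b := div_pos hA hb
    have hcb : A / b * b = A := by field_simp
    constructor <;> nlinarith [hx.1, hx.2]
  have hc0 : A / b ≠ 0 := (div_pos hA hb).ne'
  have hscale : ContDiffOn ℝ ∞ (fun x => x * (A / b)) (Ioo (-(b / 2)) (b / 2)) :=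
    (contDiff_id.mul contDiff_const).contDiffOn
  have hH := hGc.comp hscale hmap
  have hw : ∀ x ∈ Ioo (-(b / 2)) (b / 2), 0 < discWidth r (G (x * (A / b))) := fun x hx =>
    discWidth_pos (hG (hmap hx))
  -- The rectangle is first rescaled to width A and height one; its vertical slices then match those
  -- of the disc by area.
  refine ⟨stretch (fun x => G (x * (A / b))) fun x => (discWidth r (G (x * (A / b))))⁻¹ * (A / b),
    ?_, ?_, fun z hz him => ?_⟩
  · refine isAreaPreservingOn_stretch isOpen_Ioo hH ?_ ?_ ?_
    · exact (((contDiffOn_discWidth r).comp hH fun x hx => hG (hmap hx)).inv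
        fun x hx => (hw x hx).ne').mul contDiffOn_const
    · intro x hx
      have h1 : HasDerivAt (fun x => x * (A / b)) (A / b) x := by
        simpa using (hasDerivAt_id x).mul_const (A / b)
      exact (hGd _ (hmap hx)).comp x h1
    · exact fun x hx => mul_ne_zero (inv_ne_zero (hw x hx).ne') hc0
  · refine injOn_stretch (fun x hx y hy h => ?_)
      fun x hx => mul_ne_zero (inv_ne_zero (hw x hx).ne') hc0
    have := congrArg (discArea r) h
    simp only [hFG _ (hmap hx), hFG _ (hmap hy)] at this
    exact mul_right_cancel₀ hc0 this
  · have hGz := hG (hmap hz)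
    have hsq := Real.sq_sqrt (sq_sub_sq_pos_of_mem hGz).le
    have hs := Real.sqrt_pos.2 (sq_sub_sq_pos_of_mem hGz)
    rw [hAdef, mem_openDisc_iff]
    simp only [stretch]
    suffices h : |z.im / ((discWidth r (G (z.re * (A / b))))⁻¹ * (A / b))| <
        √(r ^ 2 - G (z.re * (A / b)) ^ 2) by
      have := sq_lt_sq' (by linarith [abs_nonneg (z.im /
        ((discWidth r (G (z.re * (A / b))))⁻¹ * (A / b)))]) h
      rw [hsq, sq_abs] at this
      linarith
    have hw' := hw _ hz
    rw [abs_div, abs_of_pos (mul_pos (inv_pos.2 hw') (div_pos hA hb)),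
      div_lt_iff₀ (mul_pos (inv_pos.2 hw') (div_pos hA hb)), discWidth]
    beta_reduce at hs
    generalize √(r ^ 2 - G (z.re * (A / b)) ^ 2) = R at hs ⊢
    field_simp
    linarith

/-- An area preserving embedding of the disc of area `a` into the strip of width `u'`. -/
theorem IsWrappingProfile.exists_disc_to_strip {m N : ℕ} {A a : ℝ} {u u' κ : ℝ → ℝ}
    {C C' : Fin m → ℝ → ℝ} {s t : ℝ} (h : IsWrappingProfile N A a u u' κ C C' s t) (ha : 0 < a) :
    ∃ φ : ℂ → ℂ, IsAreaPreservingOn φ (openDisc a) ∧ InjOn φ (openDisc a) ∧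
      ∀ z ∈ openDisc a, (φ z).re ∈ Ioo s t ∧ |(φ z).im| < u' (φ z).re / 2 := by
  obtain ⟨φ, hφ, hinj, hmem⟩ := exists_disc_to_rectangle ha
  have hcont : Continuous u := h.contDiff_u.continuous
  have hex : ∀ y : ℝ, ∃ x, y ∈ Ioo (-(a / 2)) (a / 2) → x ∈ Ioo s t ∧ u x = y := by
    intro y
    by_cases hy : y ∈ Ioo (-(a / 2)) (a / 2)
    · obtain ⟨x, hx, rfl⟩ := intermediate_value_Ioo h.le hcont.continuousOn
        (Ioo_subset_Ioo h.u_left h.u_right hy)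
      exact ⟨x, fun _ => ⟨hx, rfl⟩⟩
    · exact ⟨0, fun h => absurd h hy⟩
  choose G hG using hex
  have hmono : StrictMono u := strictMono_of_hasDerivAt_pos h.hasDerivAt_u h.u'_pos
  obtain ⟨hGc, hGd⟩ := contDiffOn_of_rightInverse (I := univ) isOpen_univ h.contDiff_u.contDiffOn
    (fun x _ => h.hasDerivAt_u x) (fun x _ => (h.u'_pos x).ne') hmono.injective.injOn
    (mapsTo_univ G (Ioo (-(a / 2)) (a / 2))) (fun y hy => (hG y hy).2) isOpen_Ioo
  have hpos : ∀ x, (u' (G x))⁻¹ ≠ 0 := fun x => inv_ne_zero (h.u'_pos _).ne'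
  have hmaps : MapsTo φ (openDisc a) {z | z.re ∈ Ioo (-(a / 2)) (a / 2)} := fun z hz =>
    abs_lt.1 (hmem z hz).1
  -- The inverse of `u` has slope 1/u', so unit heights become u'.
  refine ⟨stretch G (fun x => (u' (G x))⁻¹) ∘ φ, ?_, ?_, fun z hz => ⟨?_, ?_⟩⟩
  · refine (isAreaPreservingOn_stretch isOpen_Ioo hGc ?_ hGd fun x _ => hpos x).comp hφ
      (isOpen_setOf_re_mem isOpen_Ioo) (isOpen_openDisc a) hmaps
    exact (h.contDiff_u'.comp_contDiffOn hGc).inv fun x _ => (h.u'_pos _).ne'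
  · refine (injOn_stretch (I := Ioo (-(a / 2)) (a / 2)) (fun x hx y hy hxy => ?_)
      fun x _ => hpos x).comp hinj hmaps
    rw [← (hG x hx).2, hxy, (hG y hy).2]
  · exact (hG _ (hmaps hz)).1
  · have h1 := h.u'_pos (G (φ z).re)
    simp only [Function.comp_apply, stretch, div_inv_eq_mul]
    rw [abs_mul, abs_of_pos h1]
    nlinarith [(hmem z hz).2]

theorem abs_sum_mul_le {m : ℕ} {c x : Fin m → ℝ} {b : ℝ} (hx : ∀ i, |x i| ≤ b) :
    |∑ i, c i * x i| ≤ b * ∑ i, |c i| := by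
  refine (Finset.abs_sum_le_sum_abs _ _).trans ?_
  rw [Finset.mul_sum]
  refine Finset.sum_le_sum fun i _ => ?_
  rw [abs_mul, mul_comm]
  exact mul_le_mul_of_nonneg_right (hx i) (abs_nonneg _)

/-! ### Injectivity of the wrapping and the embedding. -/

/-- The set of points of `ℂᵐ × ℂ` over the strip of width `u'`, with fibres the product of
rectangles of width `π` and height one. -/
def stripBundle {m : ℕ} (u' : ℝ → ℝ) (s t : ℝ) : Set (Fin (m + 1) → ℂ) :=
  {w | (∀ i : Fin m, |(w i.castSucc).re| < Real.pi / 2 ∧ |(w i.castSucc).im| < 1 / 2) ∧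
    (w (Fin.last m)).re ∈ Ioo s t ∧ |(w (Fin.last m)).im| < u' (w (Fin.last m)).re / 2}

section wrapping

variable {m N : ℕ} {A a : ℝ} {u u' κ : ℝ → ℝ} {C C' : Fin m → ℝ → ℝ} {s t : ℝ}

/-- Since |x| < π/2 in every fibre direction, the term C'·x widens the strip by at most π/2 · Σ|C'|
on either side of its centre line κ. -/
theorem abs_shear_last_im_sub_lt {w : Fin (m + 1) → ℂ} (hw : w ∈ stripBundle u' s t) :
    |(shear C C' κ w (Fin.last m)).im - κ (w (Fin.last m)).re| <
      u' (w (Fin.last m)).re / 2 + Real.pi / 2 * ∑ i, |C' i (w (Fin.last m)).re| := by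
  rw [shear_last_im]
  have h1 := abs_sum_mul_le (c := fun i => C' i (w (Fin.last m)).re) fun i => (hw.1 i).1.le
  have h2 := abs_add_le (w (Fin.last m)).im
    (∑ j, C' j (w (Fin.last m)).re * (w (Fin.castSucc j)).re)
  rw [show ∀ x y z : ℝ, x + (y + z) - z = x + y by intros; ring]
  linarith [hw.2.2]

/-- Points of the sheared bundle on different turns of the annulus do not coincide. -/
theorem IsWrappingProfile.shear_ne (h : IsWrappingProfile N A a u u' κ C C' s t)
    {w w' : Fin (m + 1) → ℂ} (hw : w ∈ stripBundle u' s t) (hw' : w' ∈ stripBundle u' s t)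
    (hfib : ∀ i : Fin m, shear C C' κ w i.castSucc = shear C C' κ w' i.castSucc)
    (him : (shear C C' κ w (Fin.last m)).im = (shear C C' κ w' (Fin.last m)).im) {n : ℕ}
    (hn : 1 ≤ n) : (w' (Fin.last m)).re ≠ (w (Fin.last m)).re + n := by
  intro hre
  have hmem := hw'.2.1
  have h1 := abs_shear_last_im_sub_lt (C := C) (C' := C') (κ := κ) hw
  have h2 := abs_shear_last_im_sub_lt (C := C) (C' := C') (κ := κ) hw'
  rw [hre] at hmem h2
  rw [← him] at h2
  -- Either the common height would lie in two disjoint intervals, or two points of unit-height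
  -- fibres would differ by at least one in some direction.
  rcases h.separated _ hw.2.1 n hn hmem with hs | ⟨i, hi⟩
  · have h3 := abs_sub_le (κ (w (Fin.last m)).re) (shear C C' κ w (Fin.last m)).im
      (κ ((w (Fin.last m)).re + n))
    rw [abs_sub_comm (κ (w (Fin.last m)).re) (shear C C' κ w (Fin.last m)).im] at h3
    linarith
  · have h4 := congrArg Complex.im (hfib i)
    rw [shear_castSucc_im, shear_castSucc_im, hre] at h4
    have h5 := (abs_sub (w' i.castSucc).im (w i.castSucc).im).trans_lt
      (add_lt_add (hw'.1 i).2 (hw.1 i).2)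
    rw [show C i (w (Fin.last m)).re - C i ((w (Fin.last m)).re + n) =
      (w' i.castSucc).im - (w i.castSucc).im by linarith] at hi
    linarith

theorem IsWrappingProfile.shear_last_im_mem (h : IsWrappingProfile N A a u u' κ C C' s t)
    {w : Fin (m + 1) → ℂ} (hw : w ∈ stripBundle u' s t) :
    (shear C C' κ w (Fin.last m)).im ∈ Ioo (-(A / 2)) (A / 2) := by
  have h1 := abs_shear_last_im_sub_lt (C := C) (C' := C') (κ := κ) hw
  have h2 := h.abs_κ_add_le _ hw.2.1
  have h3 := abs_sub_abs_le_abs_sub (shear C C' κ w (Fin.last m)).im (κ (w (Fin.last m)).re)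
  exact abs_lt.1 (by linarith)

theorem shear_castSucc_re_mem {w : Fin (m + 1) → ℂ} (hw : w ∈ stripBundle u' s t) (i : Fin m) :
    (shear C C' κ w i.castSucc).re ∈ Ioo (-(Real.pi / 2)) (Real.pi / 2) := by
  rw [shear_re]
  exact abs_lt.1 (hw.1 i).1

end wrapping

/-- Symplectic wrapping of a polydisc with a long last factor into a cube. -/
theorem symplecticallyEmbeds_of_lt (m N : ℕ) {A a : ℝ} (ha : 0 < a) (hA : 2 * Real.pi < A)
    (hN : (N + 1) * Real.pi < A)
    (hvol : a - 2 * Real.pi < (N + 1) ^ m * (A - 2 * Real.pi)) :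
    SymplecticallyEmbeds (skinnyPolydisc (m + 1) a) (symplecticCube (m + 1) A) := by
  have hpi := Real.pi_pos
  obtain ⟨u, u', κ, C, C', s, t, h⟩ := exists_isWrappingProfile m N hA hvol
  obtain ⟨f, hf, hfinj, hfmem⟩ := exists_disc_to_rectangle hpi
  obtain ⟨b, hb, hbinj, hbmem⟩ := h.exists_disc_to_strip ha
  obtain ⟨r, hr, hrinj, hrmem⟩ := exists_rectangle_to_disc (by linarith : 0 < A) hpi
  let U : Fin (m + 1) → Set ℂ := fun i => openDisc (if (i : ℕ) + 1 = m + 1 then a else Real.pi)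
  have hUf : ∀ i : Fin m, U i.castSucc = openDisc Real.pi := fun i => by
    simp [U, i.isLt.ne]
  have hUl : U (Fin.last m) = openDisc a := by simp [U]
  have hU : skinnyPolydisc (m + 1) a = {z | ∀ i, z i ∈ U i} := rfl
  let φ₁ : Fin (m + 1) → ℂ → ℂ := Fin.lastCases b fun _ => f
  have hφ₁f : ∀ i : Fin m, φ₁ i.castSucc = f := fun i => by simp [φ₁]
  have hφ₁l : φ₁ (Fin.last m) = b := by simp [φ₁]
  let V : Fin (m + 1) → Set ℂ := Fin.lastCases {z | z.im ∈ Ioo (-(A / 2)) (A / 2)}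
    fun _ => {z | z.re ∈ Ioo (-(Real.pi / 2)) (Real.pi / 2)}
  have hVf : ∀ i : Fin m, V i.castSucc = {z | z.re ∈ Ioo (-(Real.pi / 2)) (Real.pi / 2)} :=
    fun i => by simp [V]
  have hVl : V (Fin.last m) = {z | z.im ∈ Ioo (-(A / 2)) (A / 2)} := by simp [V]
  let φ₃ : Fin (m + 1) → ℂ → ℂ := Fin.lastCases (wrap A) fun _ => r
  have hφ₃f : ∀ i : Fin m, φ₃ i.castSucc = r := fun i => by simp [φ₃]
  have hφ₃l : φ₃ (Fin.last m) = wrap A := by simp [φ₃]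
  have hUo : ∀ i, IsOpen (U i) := fun i => isOpen_openDisc _
  have hVo : ∀ i, IsOpen (V i) := fun i => by
    refine Fin.lastCases ?_ (fun i => ?_) i
    · rw [hVl]; exact isOpen_Ioo.preimage Complex.continuous_im
    · rw [hVf]; exact isOpen_setOf_re_mem isOpen_Ioo
  have h₁ : ∀ i, IsAreaPreservingOn (φ₁ i) (U i) := fun i => by
    refine Fin.lastCases ?_ (fun i => ?_) i
    · rw [hφ₁l, hUl]; exact hb
    · rw [hφ₁f, hUf]; exact hf
  have h₃ : ∀ i, IsAreaPreservingOn (φ₃ i) (V i) := fun i => by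
    refine Fin.lastCases ?_ (fun i => ?_) i
    · rw [hφ₃l, hVl]; exact isAreaPreservingOn_wrap A
    · rw [hφ₃f, hVf]; exact hr
  let Φ₁ : (Fin (m + 1) → ℂ) → (Fin (m + 1) → ℂ) := fun z i => φ₁ i (z i)
  let Φ₃ : (Fin (m + 1) → ℂ) → (Fin (m + 1) → ℂ) := fun z i => φ₃ i (z i)
  have hUopen : IsOpen (skinnyPolydisc (m + 1) a) := IsOpen.setOf_forall_mem hUo
  have hVopen : IsOpen {z : Fin (m + 1) → ℂ | ∀ i, z i ∈ V i} := IsOpen.setOf_forall_mem hVo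
  have hm₁ : MapsTo Φ₁ (skinnyPolydisc (m + 1) a) (stripBundle u' s t) := by
    intro z hz
    refine ⟨fun i => ?_, ?_⟩
    · have := hz i.castSucc
      simp only [Φ₁, hφ₁f]
      exact hfmem _ (hUf i ▸ this)
    · have := hz (Fin.last m)
      simp only [Φ₁, hφ₁l]
      exact hbmem _ (hUl ▸ this)
  have hm₂ : MapsTo (shear C C' κ) (stripBundle u' s t) {z | ∀ i, z i ∈ V i} := by
    intro w hw i
    refine Fin.lastCases ?_ (fun i => ?_) i
    · rw [hVl]; exact h.shear_last_im_mem hw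
    · rw [hVf]; exact shear_castSucc_re_mem hw i
  have hΦ₁inj : InjOn Φ₁ (skinnyPolydisc (m + 1) a) := by
    intro z hz w hw hzw
    funext i
    have hi : φ₁ i (z i) = φ₁ i (w i) := congrFun hzw i
    have hzi : z i ∈ U i := hz i
    have hwi : w i ∈ U i := hw i
    revert hi hzi hwi
    refine Fin.lastCases ?_ (fun i => ?_) i
    · rw [hφ₁l, hUl]; exact fun hi hzi hwi => hbinj hzi hwi hi
    · rw [hφ₁f, hUf]; exact fun hi hzi hwi => hfinj hzi hwi hi
  have hinj₂₃ : InjOn (Φ₃ ∘ shear C C' κ) (stripBundle u' s t) := by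
    intro w hw w' hw' heq
    have hfib : ∀ i : Fin m, shear C C' κ w i.castSucc = shear C C' κ w' i.castSucc := by
      intro i
      have hi : φ₃ i.castSucc _ = φ₃ i.castSucc _ := congrFun heq i.castSucc
      rw [hφ₃f] at hi
      exact hrinj (shear_castSucc_re_mem hw i) (shear_castSucc_re_mem hw' i) hi
    have hl : φ₃ (Fin.last m) _ = φ₃ (Fin.last m) _ := congrFun heq (Fin.last m)
    rw [hφ₃l] at hl
    obtain ⟨him, k, hk⟩ := wrap_eq_iff (h.shear_last_im_mem hw) (h.shear_last_im_mem hw') hl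
    rw [shear_re, shear_re] at hk
    -- Wrapping identifies only integer translates in θ. Nonzero translates are excluded by
    -- separation, after exchanging the points if k < 0, and k = 0 is injectivity of the shear.
    rcases lt_trichotomy k 0 with hk0 | rfl | hk0
    · obtain ⟨n, rfl⟩ : ∃ n : ℕ, k = -n := ⟨k.natAbs, by omega⟩
      push_cast at hk
      exact absurd (by linarith : (w (Fin.last m)).re = (w' (Fin.last m)).re + n)
        (h.shear_ne hw' hw (fun i => (hfib i).symm) him.symm (by omega))
    · refine shear_injective (C := C) (C' := C') (κ := κ) (funext fun i => ?_)
      refine Fin.lastCases ?_ hfib i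
      refine Complex.ext ?_ him
      rw [shear_re, shear_re, hk, Int.cast_zero, add_zero]
    · obtain ⟨n, rfl⟩ : ∃ n : ℕ, k = n := ⟨k.natAbs, by omega⟩
      exact absurd (by exact_mod_cast hk) (h.shear_ne hw hw' hfib him (n := n) (by omega))
  have hs₁ : IsSymplecticOn Φ₁ (skinnyPolydisc (m + 1) a) := isSymplecticOn_pi h₁ hUo
  have hs₂₁ := (isSymplecticOn_shear h.contDiff_C h.contDiff_C' h.contDiff_κ h.hasDerivAt_C).comp
    hs₁ isOpen_univ hUopen (mapsTo_univ _ _)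
  have hs := (isSymplecticOn_pi h₃ hVo).comp hs₂₁ hVopen hUopen (hm₂.comp hm₁)
  refine ⟨_, hs.isSymplecticEmbeddingOn hUopen (hinj₂₃.comp hΦ₁inj hm₁), fun z hz i => ?_⟩
  have hw := hm₁ hz
  change φ₃ i (shear C C' κ (Φ₁ z) i) ∈ openDisc A
  refine Fin.lastCases ?_ (fun i => ?_) i
  · have hmem := h.shear_last_im_mem hw
    rw [hφ₃l]
    change Real.pi * ‖wrap A _‖ ^ 2 < A
    rw [normSq_wrap hmem]
    linarith [hmem.2]
  · rw [hφ₃f]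
    refine hrmem _ (shear_castSucc_re_mem hw i) ?_
    rw [shear_castSucc_im]
    have h1 := abs_add_le (Φ₁ z i.castSucc).im (C i (Φ₁ z (Fin.last m)).re)
    have h2 := h.abs_C_le _ hw.2.1 i
    have h3 := (hw.1 i).2
    -- The fibre height is below 1/2 + N/2, and multiplying by π gives less than A/2 because (N +
    -- 1)π < A.
    nlinarith

/-! ### Numerical bounds and the theorem. -/

/-- The numerical conditions under which the wrapping construction applies to `sPC n a + ε`. -/
theorem sPC_add_bounds (n : ℕ) {a ε : ℝ} (ha : 2 * Real.pi < a) (hε : 0 < ε) :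
    ∃ N : ℕ, 1 ≤ N ∧ (N + 1) * Real.pi < sPC n a + ε ∧
      a - 2 * Real.pi < (N + 1) ^ (n - 1) * (sPC n a + ε - 2 * Real.pi) := by
  have hpi := Real.pi_pos
  obtain ⟨N, hN, h1, h2⟩ := exists_foldNumber n a ha
  have hp : (0 : ℝ) < ((N : ℝ) + 1) ^ (n - 1) := by positivity
  refine ⟨N, hN, ?_⟩
  have hdiv : a = a / Real.pi * Real.pi := by field_simp
  -- The threshold is where (N + 1)π equals (a - 2π)/(N + 1)^(n-1) + 2π: below it room in the fibre
  -- is the binding condition, above it area is.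
  rcases le_or_gt (a / Real.pi - 2) (((N : ℝ) - 1) * ((N : ℝ) + 1) ^ (n - 1)) with h | h
  · rw [sPC_eq_lower n a N hN h1 h]
    have := mul_le_mul_of_nonneg_right h hpi.le
    have := mul_pos hp hε
    constructor <;> nlinarith
  · rw [sPC_eq_upper n a N hN h h2]
    have h3 := mul_lt_mul_of_pos_right h hpi
    have h4 : ((N : ℝ) - 1) * Real.pi < (a - 2 * Real.pi) / ((N : ℝ) + 1) ^ (n - 1) := by
      rw [lt_div_iff₀ hp]; nlinarith
    constructor
    · linarith
    · rw [show (a - 2 * Real.pi) / ((N : ℝ) + 1) ^ (n - 1) + 2 * Real.pi + ε - 2 * Real.pi =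
        (a - 2 * Real.pi) / ((N : ℝ) + 1) ^ (n - 1) + ε by ring, mul_add, mul_div_cancel₀ _ hp.ne']
      linarith [mul_pos hp hε]

theorem mainTheorem10 :
    (∀ (n : ℕ) (a ε : ℝ), 1 ≤ n → 2 * Real.pi < a → 0 < ε →
      SymplecticallyEmbeds (skinnyPolydisc n a) (symplecticCube n (sPC n a + ε))) ∧
    (∀ (a : ℝ) (N : ℕ), 2 * Real.pi < a → 1 ≤ N →
      (((N : ℝ) - 1) * N + 2 < a / Real.pi → a / Real.pi ≤ (N : ℝ) ^ 2 + 1 →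
        sPC 2 a = ((N : ℝ) + 1) * Real.pi) ∧
      ((N : ℝ) ^ 2 + 1 < a / Real.pi → a / Real.pi ≤ (N : ℝ) * ((N : ℝ) + 1) + 2 →
        sPC 2 a = (a + 2 * N * Real.pi) / ((N : ℝ) + 1))) := by
  have hpi := Real.pi_pos
  refine ⟨fun n a ε hn ha hε => ?_, fun a N _ hN => ⟨fun h1 h2 => ?_, fun h1 h2 => ?_⟩⟩
  · obtain ⟨N, hN, h1, h2⟩ := sPC_add_bounds n ha hε
    obtain ⟨m, rfl⟩ : ∃ m, n = m + 1 := ⟨n - 1, by omega⟩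
    have hN' : (1 : ℝ) ≤ N := by exact_mod_cast hN
    have h3 : 2 * Real.pi ≤ (N + 1) * Real.pi :=
      mul_le_mul_of_nonneg_right (by linarith) hpi.le
    exact symplecticallyEmbeds_of_lt m N ((mul_pos two_pos hpi).trans ha) (h3.trans_lt h1) h1 h2
  · refine sPC_eq_lower 2 a N hN ?_ ?_ <;> norm_num <;> linarith
  · rw [sPC_eq_upper 2 a N hN (by norm_num; linarith) (by norm_num; linarith)]
    have : (N : ℝ) + 1 ≠ 0 := by positivity
    norm_num
    field_simp
    ring
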